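/- Let $Q$ be a finite-dimensional smooth manifold without boundary and let $k\ge 0$. A *discretization map* on a manifold $M$ is a smooth map $R=(R^1,R^2):U\to M\times M$, defined on an open neighbourhood $U\subseteq TM$ of the zero section, such that for every $q\in M$ 1. $R(0_q)=(q,q)$, and 2. $T_{0_q}R^2_q-T_{0_q}R^1_q=\mathrm{Id}_{T_qM}$, where $R^a_q$ is the restriction of $R^a$ to $U\cap T_qM$ and $T_{0_q}(T_qM)$ is identified with $T_qM$. Let $T^{(k)}M$ be the $k$-th order tangent bundle, i.e. the set of $k$-jets $j_0^{(k)}c$ at $0$ of smooth curves $c$ in $M$ defined around $0$ (two curves have the same $k$-jet if they have the same value and, in a chart, the same derivatives of orders $1,\dots,k$ at $0$), with the smooth structure given by the coordinates $\frac1{r!}\frac{d^r}{dt^r}\big|_{t=0}(x\circ c)$, $0\le r\le k$, for the charts $x$ of $M$. A smooth map $F:M\to N$ induces $T^{(k)}F:T^{(k)}M\to T^{(k)}N$, $T^{(k)}F(j_0^{(k)}c)=j_0^{(k)}(F\circ c)$, and $T^{(k)}(M\times M)$ is identified with $T^{(k)}M\times T^{(k)}M$. Let $\Phi^{(k)}:T(T^{(k)}Q)\to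 T^{(k)}(TQ)$ be the canonical identification $$\Phi^{(k)}\Big(\tfrac{d}{dt}\Big|_{t=0}\,j_0^{(k)}\big(s\mapsto c(t,s)\big)\Big)=j_0^{(k)}\Big(s\mapsto\tfrac{d}{dt}\Big|_{t=0}c(t,s)\Big),$$ where $c$ is any smooth map from a neighbourhood of $(0,0)$ in $\mathbb R^2$ to $Q$. **Theorem.** Let $R_d:U\subseteq TQ\to Q\times Q$ be a discretization map on $Q$. Then its $k$-th order lift $$R_d^{(k)}=T^{(k)}R_d\circ\Phi^{(k)}:\;(\Phi^{(k)})^{-1}(T^{(k)}U)\subseteq T(T^{(k)}Q)\to T^{(k)}Q\times T^{(k)}Q$$ is a discretization map on $T^{(k)}Q$: its domain is an open neighbourhood of the zero section (and is all of $T(T^{(k)}Q)$ if $U=TQ$), it is smooth, $R_d^{(k)}(0_z)=(z,z)$ for every $z\in T^{(k)}Q$, and the difference of the derivatives at $0_z$ of the restrictions to $T_z(T^{(k)}Q)$ of its second and first components is the identity of $T_z(T^{(k)}Q)$. -/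

import Mathlib

open Set Filter Topology Bundle
open scoped Manifold ContDiff

set_option linter.unusedSectionVars false

noncomputable section

namespace HigherTangent

section Calculus

variable {E E' V : Type*} [NormedAddCommGroup E] [NormedSpace ℝ E]
  [NormedAddCommGroup E'] [NormedSpace ℝ E'] [NormedAddCommGroup V] [NormedSpace ℝ V]

lemma iteratedDeriv_comp_congr {k : ℕ} {f g : ℝ → E} {φ : E → E'}
    (hf : ContDiffAt ℝ ∞ f 0) (hg : ContDiffAt ℝ ∞ g 0) (hφ : ContDiffAt ℝ ∞ φ (f 0))
    (h : ∀ i ≤ k, iteratedDeriv i f 0 = iteratedDeriv i g 0) {i : ℕ} (hi : i ≤ k) :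
    iteratedDeriv i (φ ∘ f) 0 = iteratedDeriv i (φ ∘ g) 0 := by
  have h0 : f 0 = g 0 := by simpa using h 0 (Nat.zero_le _)
  have hF : ∀ j ≤ k, iteratedFDeriv ℝ j f 0 = iteratedFDeriv ℝ j g 0 := by
    intro j hj
    simp only [iteratedFDeriv_eq_equiv_comp, Function.comp_apply, h j hj]
  have hle : ((i : ℕ) : ℕ∞ω) ≤ ∞ := mod_cast le_top
  rw [iteratedDeriv_eq_iteratedFDeriv, iteratedDeriv_eq_iteratedFDeriv,
    iteratedFDeriv_comp hφ hf hle, iteratedFDeriv_comp (h0 ▸ hφ) hg hle, h0]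
  congr 1
  simp only [FormalMultilinearSeries.taylorComp]
  refine Finset.sum_congr rfl fun c _ => ?_
  simp only [FormalMultilinearSeries.compAlongOrderedFinpartition]
  congr 1
  funext m
  exact hF _ ((c.partSize_le m).trans hi)

/-- The polynomial curve `t ↦ v₀ + t v₁ + ⋯ + tᵏ vₖ`. -/
def polyCurve {k : ℕ} (v : Fin (k + 1) → E) (t : ℝ) : E := ∑ j : Fin (k + 1), t ^ (j : ℕ) • v j

lemma polyCurve_zero {k : ℕ} (v : Fin (k + 1) → E) : polyCurve v 0 = v 0 := by
  simp [polyCurve, Fin.sum_univ_succ]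

lemma contDiff_polyCurve {k : ℕ} :
    ContDiff ℝ ∞ (fun p : (Fin (k + 1) → E) × ℝ => polyCurve p.1 p.2) := by
  unfold polyCurve
  fun_prop

lemma iteratedDeriv_polyCurve {k : ℕ} (v : Fin (k + 1) → E) (i : Fin (k + 1)) :
    iteratedDeriv i (polyCurve v) 0 = ((i : ℕ).factorial : ℝ) • v i := by
  have : polyCurve v = fun t => ∑ j : Fin (k + 1), (fun t : ℝ => t ^ (j : ℕ) • v j) t := rfl
  rw [this, iteratedDeriv_fun_sum (fun j _ => by fun_prop)]
  have h : ∀ j : Fin (k + 1), iteratedDeriv i (fun t : ℝ => t ^ (j : ℕ) • v j) 0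
      = if j = i then ((i : ℕ).factorial : ℝ) • v i else 0 := by
    intro j
    rw [iteratedDeriv_smul_const (by fun_prop), iteratedDeriv_fun_pow_zero]
    by_cases hji : j = i
    · simp [hji]
    · have : (i : ℕ) ≠ j := fun h => hji (Fin.ext h.symm)
      simp [hji, this]
  simp [h]

/-- Partial derivatives in the last (real) variable of a smooth map are smooth. -/
lemma contDiffOn_iteratedDeriv_snd {F : V × ℝ → E} {O : Set (V × ℝ)} (hO : IsOpen O)
    (hF : ContDiffOn ℝ ∞ F O) (i : ℕ) :
    ContDiffOn ℝ ∞ (fun p : V × ℝ => iteratedDeriv i (fun s => F (p.1, s)) p.2) O := by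
  induction i with
  | zero => simpa using hF
  | succ i ih =>
    have h1 : ContDiffOn ℝ ∞
        (fun p => fderiv ℝ (fun p : V × ℝ => iteratedDeriv i (fun s => F (p.1, s)) p.2) p (0, 1)) O :=
      (ih.fderiv_of_isOpen hO (by simp)).clm_apply contDiffOn_const
    refine h1.congr fun p hp => ?_
    have hd := ((ih.contDiffAt (hO.mem_nhds hp)).differentiableAt (by simp)).hasFDerivAt
    have h2 : HasDerivAt (fun s : ℝ => ((p.1, s) : V × ℝ)) (0, 1) p.2 :=
      (hasDerivAt_const _ _).prodMk (hasDerivAt_id _)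
    rw [iteratedDeriv_succ]
    exact (hd.comp_hasDerivAt p.2 h2).deriv

lemma contDiffOn_deriv_fst {f : ℝ × ℝ → E} {O : Set (ℝ × ℝ)} (hO : IsOpen O)
    (hf : ContDiffOn ℝ ∞ f O) :
    ContDiffOn ℝ ∞ (fun p : ℝ × ℝ => deriv (fun t => f (t, p.2)) p.1) O := by
  have h1 : ContDiffOn ℝ ∞ (fun p => fderiv ℝ f p (1, 0)) O :=
    (hf.fderiv_of_isOpen hO (by simp)).clm_apply contDiffOn_const
  refine h1.congr fun p hp => ?_
  have hd := ((hf.contDiffAt (hO.mem_nhds hp)).differentiableAt (by simp)).hasFDerivAt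
  have h2 : HasDerivAt (fun t : ℝ => ((t, p.2) : ℝ × ℝ)) (1, 0) p.1 :=
    (hasDerivAt_id _).prodMk (hasDerivAt_const _ _)
  exact (hd.comp_hasDerivAt p.1 h2).deriv

lemma deriv_swap {f : ℝ × ℝ → E} {O : Set (ℝ × ℝ)} (hO : IsOpen O)
    (hf : ContDiffOn ℝ ∞ f O) {p : ℝ × ℝ} (hp : p ∈ O) :
    deriv (fun t => deriv (fun s => f (t, s)) p.2) p.1 =
      deriv (fun s => deriv (fun t => f (t, s)) p.1) p.2 := by
  have hi1 : ∀ q : ℝ × ℝ, HasDerivAt (fun t : ℝ => ((t, q.2) : ℝ × ℝ)) (1, 0) q.1 := fun q =>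
    (hasDerivAt_id _).prodMk (hasDerivAt_const _ _)
  have hi2 : ∀ q : ℝ × ℝ, HasDerivAt (fun s : ℝ => ((q.1, s) : ℝ × ℝ)) (0, 1) q.2 := fun q =>
    (hasDerivAt_const _ _).prodMk (hasDerivAt_id _)
  have hd : ∀ q ∈ O, HasFDerivAt f (fderiv ℝ f q) q := fun q hq =>
    ((hf.contDiffAt (hO.mem_nhds hq)).differentiableAt (by simp)).hasFDerivAt
  have hd2 : HasFDerivAt (fderiv ℝ f) (fderiv ℝ (fderiv ℝ f) p) p :=
    ((((hf.fderiv_of_isOpen (m := ∞) hO (by simp)).contDiffAt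
      (hO.mem_nhds hp)).differentiableAt (by simp))).hasFDerivAt
  have e1 : (fun t => deriv (fun s => f (t, s)) p.2) =ᶠ[𝓝 p.1]
      fun t => fderiv ℝ f (t, p.2) (0, 1) := by
    filter_upwards [(hi1 p).continuousAt.eventually (hO.mem_nhds hp)] with t ht
    exact ((hd _ ht).comp_hasDerivAt p.2 (hi2 (t, p.2))).deriv
  have e2 : (fun s => deriv (fun t => f (t, s)) p.1) =ᶠ[𝓝 p.2]
      fun s => fderiv ℝ f (p.1, s) (1, 0) := by
    filter_upwards [(hi2 p).continuousAt.eventually (hO.mem_nhds hp)] with s hs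
    exact ((hd _ hs).comp_hasDerivAt p.1 (hi1 (p.1, s))).deriv
  have d1 : HasDerivAt (fun t => fderiv ℝ f (t, p.2) (0, 1))
      (fderiv ℝ (fderiv ℝ f) p (1, 0) (0, 1)) p.1 :=
    (ContinuousLinearMap.apply ℝ E ((0, 1) : ℝ × ℝ)).hasFDerivAt.comp_hasDerivAt p.1
      (hd2.comp_hasDerivAt p.1 (hi1 p))
  have d2 : HasDerivAt (fun s => fderiv ℝ f (p.1, s) (1, 0))
      (fderiv ℝ (fderiv ℝ f) p (0, 1) (1, 0)) p.2 :=
    (ContinuousLinearMap.apply ℝ E ((1, 0) : ℝ × ℝ)).hasFDerivAt.comp_hasDerivAt p.2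
      (hd2.comp_hasDerivAt p.2 (hi2 p))
  have hsymm : IsSymmSndFDerivAt ℝ f p :=
    (hf.contDiffAt (hO.mem_nhds hp)).isSymmSndFDerivAt
      (by simp only [minSmoothness_of_isRCLikeNormedField]; exact WithTop.coe_le_coe.2 le_top)
  rw [e1.deriv_eq, e2.deriv_eq, d1.deriv, d2.deriv]
  exact hsymm (1, 0) (0, 1)

lemma deriv_iteratedDeriv_swap {f : ℝ × ℝ → E} {O : Set (ℝ × ℝ)} (hO : IsOpen O)
    (hf : ContDiffOn ℝ ∞ f O) (r : ℕ) {p : ℝ × ℝ} (hp : p ∈ O) :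
    deriv (fun t => iteratedDeriv r (fun s => f (t, s)) p.2) p.1 =
      iteratedDeriv r (fun s => deriv (fun t => f (t, s)) p.1) p.2 := by
  induction r generalizing p with
  | zero => simp
  | succ r ih =>
    simp only [iteratedDeriv_succ]
    have h := deriv_swap hO (contDiffOn_iteratedDeriv_snd hO hf r) hp
    simp only at h
    rw [h]
    refine Filter.EventuallyEq.deriv_eq ?_
    have hc : ContinuousAt (fun s : ℝ => ((p.1, s) : ℝ × ℝ)) p.2 := by fun_prop
    filter_upwards [hc.eventually (hO.mem_nhds hp)] with s hs
    exact ih hs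

lemma iteratedDeriv_prodMk {f : ℝ → E} {g : ℝ → E'} {x : ℝ} (hf : ContDiffAt ℝ ∞ f x)
    (hg : ContDiffAt ℝ ∞ g x) (i : ℕ) :
    iteratedDeriv i (fun t => (f t, g t)) x = (iteratedDeriv i f x, iteratedDeriv i g x) := by
  simp only [iteratedDeriv_eq_iteratedFDeriv]
  rw [iteratedFDeriv_prodMk hf hg (mod_cast le_top)]
  rfl

end Calculus

section Jets

variable {E H M : Type*} [NormedAddCommGroup E] [NormedSpace ℝ E] [TopologicalSpace H]
  [TopologicalSpace M] [ChartedSpace H M]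

/-- `c` is a smooth curve through `c 0`, defined on an interval around `0`
(its values away from `0` are irrelevant). -/
def IsCurve (I : ModelWithCorners ℝ E H) (c : ℝ → M) : Prop :=
  ∀ᶠ t in 𝓝 (0 : ℝ), ContMDiffAt 𝓘(ℝ, ℝ) I ∞ c t

/-- Smooth curves in `M` defined around `0`. -/
abbrev Curve (I : ModelWithCorners ℝ E H) (M : Type*) [TopologicalSpace M] [ChartedSpace H M] :
    Type _ :=
  {c : ℝ → M // IsCurve I c}

/-- The relation `∼ₖ`: the curves have the same value at `0` and, in the chart at that point,
the same derivatives at `0` up to order `k`. -/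
def jetSetoid (I : ModelWithCorners ℝ E H) (k : ℕ) (M : Type*) [TopologicalSpace M]
    [ChartedSpace H M] : Setoid (Curve I M) where
  r c₁ c₂ := c₁.1 0 = c₂.1 0 ∧ ∀ i ≤ k,
    iteratedDeriv i (extChartAt I (c₁.1 0) ∘ c₁.1) 0 =
      iteratedDeriv i (extChartAt I (c₁.1 0) ∘ c₂.1) 0
  iseqv :=
    { refl := fun _ => ⟨rfl, fun _ _ => rfl⟩
      symm := fun h => ⟨h.1.symm, fun i hi => h.1 ▸ (h.2 i hi).symm⟩
      trans := fun h h' => ⟨h.1.trans h'.1, fun i hi =>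
        (h.2 i hi).trans (by have := h'.2 i hi; rwa [← h.1] at this)⟩ }

/-- The `k`-th order tangent bundle `T⁽ᵏ⁾M`: the set of `k`-jets at `0` of curves in `M`. -/
def JetBundle (I : ModelWithCorners ℝ E H) (k : ℕ) (M : Type*) [TopologicalSpace M]
    [ChartedSpace H M] : Type _ :=
  Quotient (jetSetoid I k M)

lemma isCurve_const (I : ModelWithCorners ℝ E H) (q : M) : IsCurve I (fun _ : ℝ => q) :=
  Eventually.of_forall fun _ => contMDiffAt_const

/-- The `k`-jet of a smooth curve, as an equivalence class. -/
def Curve.toJet {I : ModelWithCorners ℝ E H} (k : ℕ) (c : Curve I M) : JetBundle I k M :=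
  Quotient.mk (jetSetoid I k M) c

open Classical in
/-- The `k`-jet `j₀⁽ᵏ⁾c` of a curve. (If `c` is not smooth around `0`, which never matters, this is
the jet of the constant curve `c 0`.) -/
def jet (I : ModelWithCorners ℝ E H) (k : ℕ) (c : ℝ → M) : JetBundle I k M :=
  if h : IsCurve I c then Curve.toJet k ⟨c, h⟩
  else Curve.toJet k ⟨fun _ => c 0, isCurve_const I _⟩

/-- A curve that represents the given jet. -/
def JetBundle.rep {I : ModelWithCorners ℝ E H} {k : ℕ} (z : JetBundle I k M) : ℝ → M :=
  (Quotient.out z).1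

/-- The projection `T⁽ᵏ⁾M → M`, `j₀⁽ᵏ⁾c ↦ c 0`. -/
def JetBundle.base {I : ModelWithCorners ℝ E H} {k : ℕ} (z : JetBundle I k M) : M :=
  z.rep 0

/-- The lift `T⁽ᵏ⁾F : T⁽ᵏ⁾M → T⁽ᵏ⁾N`, `j₀⁽ᵏ⁾c ↦ j₀⁽ᵏ⁾(F ∘ c)`; see `jetMap_jet` for the
independence of the representing curve. -/
def jetMap {E' H' N : Type*} [NormedAddCommGroup E'] [NormedSpace ℝ E'] [TopologicalSpace H']
    [TopologicalSpace N] [ChartedSpace H' N] (I : ModelWithCorners ℝ E H)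
    (I' : ModelWithCorners ℝ E' H') (k : ℕ) (F : M → N) (z : JetBundle I k M) :
    JetBundle I' k N :=
  jet I' k (F ∘ z.rep)

variable {I : ModelWithCorners ℝ E H} {k : ℕ}

lemma JetBundle.isCurve_rep (z : JetBundle I k M) : IsCurve I z.rep := (Quotient.out z).2

lemma jet_rep (z : JetBundle I k M) : jet I k z.rep = z := by
  rw [jet, dif_pos z.isCurve_rep]
  exact Quotient.out_eq z

lemma jet_eq_jet {c₁ c₂ : ℝ → M} (h₁ : IsCurve I c₁) (h₂ : IsCurve I c₂) :
    jet I k c₁ = jet I k c₂ ↔ c₁ 0 = c₂ 0 ∧ ∀ i ≤ k,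
    iteratedDeriv i (extChartAt I (c₁ 0) ∘ c₁) 0 =
      iteratedDeriv i (extChartAt I (c₁ 0) ∘ c₂) 0 := by
  rw [jet, jet, dif_pos h₁, dif_pos h₂]
  exact Quotient.eq (r := jetSetoid I k M)

lemma IsCurve.congr {c₁ c₂ : ℝ → M} (h₁ : IsCurve I c₁) (h : c₁ =ᶠ[𝓝 0] c₂) : IsCurve I c₂ := by
  filter_upwards [h₁, h.eventuallyEq_nhds] with t ht h't
  exact ht.congr_of_eventuallyEq h't.symm

lemma IsCurve.comp {E' H' N : Type*} [NormedAddCommGroup E'] [NormedSpace ℝ E']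
    [TopologicalSpace H'] [TopologicalSpace N] [ChartedSpace H' N]
    {I' : ModelWithCorners ℝ E' H'} {F : M → N} {c : ℝ → M} (hc : IsCurve I c)
    (hF : ∀ᶠ y in 𝓝 (c 0), ContMDiffAt I I' ∞ F y) : IsCurve I' (F ∘ c) := by
  have h0 : ContinuousAt c 0 := hc.self_of_nhds.continuousAt
  filter_upwards [hc, h0.eventually hF] with t ht hFt
  exact hFt.comp t ht

lemma jet_congr {c₁ c₂ : ℝ → M} (h₁ : IsCurve I c₁) (h : c₁ =ᶠ[𝓝 0] c₂) :
    jet I k c₁ = jet I k c₂ := by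
  refine (jet_eq_jet h₁ (h₁.congr h)).2 ⟨h.self_of_nhds, fun i _ => ?_⟩
  exact Filter.EventuallyEq.iteratedDeriv_eq i (h.fun_comp _)

lemma jet_base {c : ℝ → M} (hc : IsCurve I c) : (jet I k c).base = c 0 :=
  ((jet_eq_jet (k := k) (JetBundle.isCurve_rep _) hc).1 (jet_rep _)).1

variable [IsManifold I ∞ M] [I.Boundaryless]

lemma contMDiffAt_extend_symm {e : OpenPartialHomeomorph M H} (he : e ∈ atlas H M) {y : E}
    (hy : y ∈ (e.extend I).target) : ContMDiffAt 𝓘(ℝ, E) I ∞ (e.extend I).symm y := by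
  have h := contMDiffOn_extend_symm (I := I) (n := ∞) (IsManifold.subset_maximalAtlas he)
  rw [← e.extend_target'] at h
  exact h.contMDiffAt (e.isOpen_extend_target.mem_nhds hy)

lemma contMDiffAt_extend_atlas {e : OpenPartialHomeomorph M H} (he : e ∈ atlas H M) {y : M}
    (hy : y ∈ e.source) : ContMDiffAt I 𝓘(ℝ, E) ∞ (e.extend I) y :=
  (e.contMDiffOn_extend (IsManifold.subset_maximalAtlas he)).contMDiffAt (e.open_source.mem_nhds hy)

/-- A smooth vector valued function `g` along curves that agree to order `k` in the chart `e`. -/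
lemma iteratedDeriv_congr_of_chart {E' : Type*} [NormedAddCommGroup E'] [NormedSpace ℝ E']
    {e : OpenPartialHomeomorph M H} (he : e ∈ atlas H M)
    {c₁ c₂ : ℝ → M} (h₁ : IsCurve I c₁) (h₂ : IsCurve I c₂) (h0 : c₁ 0 = c₂ 0)
    (hs : c₁ 0 ∈ e.source)
    (h : ∀ i ≤ k, iteratedDeriv i (e.extend I ∘ c₁) 0 = iteratedDeriv i (e.extend I ∘ c₂) 0)
    {g : M → E'} (hg : ContMDiffAt I 𝓘(ℝ, E') ∞ g (c₁ 0)) {i : ℕ} (hi : i ≤ k) :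
    iteratedDeriv i (g ∘ c₁) 0 = iteratedDeriv i (g ∘ c₂) 0 := by
  have key : ∀ c : ℝ → M, IsCurve I c → c 0 ∈ e.source →
      g ∘ c =ᶠ[𝓝 0] (g ∘ (e.extend I).symm) ∘ (e.extend I ∘ c) := by
    intro c hc hcs
    have h0 : ContinuousAt c 0 := hc.self_of_nhds.continuousAt
    filter_upwards [h0.eventually (e.open_source.mem_nhds hcs)] with t ht
    simp only [Function.comp_apply]
    rw [e.extend_left_inv ht]
  have key2 : ∀ c : ℝ → M, IsCurve I c → c 0 ∈ e.source →
      ContDiffAt ℝ ∞ (e.extend I ∘ c) 0 := fun c hc hcs =>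
    ((contMDiffAt_extend_atlas he hcs).comp (0 : ℝ) hc.self_of_nhds).contDiffAt
  rw [(key c₁ h₁ hs).iteratedDeriv_eq i, (key c₂ h₂ (h0 ▸ hs)).iteratedDeriv_eq i]
  refine iteratedDeriv_comp_congr (key2 c₁ h₁ hs) (key2 c₂ h₂ (h0 ▸ hs)) ?_ h hi
  have hy : e.extend I (c₁ 0) ∈ (e.extend I).target :=
    (e.extend I).map_source (by rwa [e.extend_source])
  refine (ContMDiffAt.comp (I' := I) (e.extend I (c₁ 0)) ?_ (contMDiffAt_extend_symm he hy)).contDiffAt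
  rwa [e.extend_left_inv hs]

lemma jet_eq_jet_iff {e : OpenPartialHomeomorph M H} (he : e ∈ atlas H M)
    {c₁ c₂ : ℝ → M} (h₁ : IsCurve I c₁) (h₂ : IsCurve I c₂) (hs : c₁ 0 ∈ e.source) :
    jet I k c₁ = jet I k c₂ ↔ c₁ 0 = c₂ 0 ∧ ∀ i ≤ k,
    iteratedDeriv i (e.extend I ∘ c₁) 0 = iteratedDeriv i (e.extend I ∘ c₂) 0 := by
  rw [jet_eq_jet h₁ h₂]
  refine and_congr_right fun h0 => ⟨fun h i hi => ?_, fun h i hi => ?_⟩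
  · exact iteratedDeriv_congr_of_chart (chart_mem_atlas H (c₁ 0)) h₁ h₂ h0 (mem_chart_source H _) h
      (contMDiffAt_extend_atlas he hs) hi
  · exact iteratedDeriv_congr_of_chart he h₁ h₂ h0 hs h contMDiffAt_extChartAt hi

/-- `T⁽ᵏ⁾F` does not depend on the choice of the representing curve. -/
lemma jetMap_jet {E' H' N : Type*} [NormedAddCommGroup E'] [NormedSpace ℝ E']
    [TopologicalSpace H'] [TopologicalSpace N] [ChartedSpace H' N]
    {I' : ModelWithCorners ℝ E' H'} [IsManifold I' ∞ N] {F : M → N} {c : ℝ → M}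
    (hc : IsCurve I c) (hF : ∀ᶠ y in 𝓝 (c 0), ContMDiffAt I I' ∞ F y) :
    jetMap I I' k F (jet I k c) = jet I' k (F ∘ c) := by
  have hr := JetBundle.isCurve_rep (jet I k c)
  obtain ⟨h0, h⟩ := (jet_eq_jet (k := k) hc hr).1 (jet_rep _).symm
  rw [jetMap, eq_comm, jet_eq_jet (hc.comp hF) (hr.comp (h0 ▸ hF))]
  refine ⟨congrArg F h0, fun i hi => ?_⟩
  exact iteratedDeriv_congr_of_chart (chart_mem_atlas H (c 0)) hc hr h0 (mem_chart_source H _) h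
    (g := extChartAt I' (F (c 0)) ∘ F)
    (contMDiffAt_extChartAt.comp _ hF.self_of_nhds) hi

end Jets

section JetManifold

variable {E H M : Type*} [NormedAddCommGroup E] [NormedSpace ℝ E] [TopologicalSpace H]
  [TopologicalSpace M] [ChartedSpace H M] {I : ModelWithCorners ℝ E H} {k : ℕ}

/-- The coordinates `(1/r!) (d/dt)^r (e ∘ c) (0)`, `0 ≤ r ≤ k`, of the jet of `c` in the chart `e`. -/
def jetCoord (e : OpenPartialHomeomorph M H) (z : JetBundle I k M) : Fin (k + 1) → E :=
  fun r => ((r : ℕ).factorial : ℝ)⁻¹ • iteratedDeriv r (e.extend I ∘ z.rep) 0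

variable [IsManifold I ∞ M] [I.Boundaryless]

lemma jetCoord_jet {e : OpenPartialHomeomorph M H} (he : e ∈ atlas H M) {c : ℝ → M}
    (hc : IsCurve I c) (hs : c 0 ∈ e.source) (r : Fin (k + 1)) :
    jetCoord e (jet I k c) r =
      ((r : ℕ).factorial : ℝ)⁻¹ • iteratedDeriv r (e.extend I ∘ c) 0 := by
  rw [jetCoord, ((jet_eq_jet_iff (k := k) he hc (JetBundle.isCurve_rep _) hs).1
    (jet_rep (jet I k c)).symm).2 r (Nat.lt_succ_iff.1 r.2)]

lemma isCurve_symm_polyCurve {e : OpenPartialHomeomorph M H} (he : e ∈ atlas H M)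
    {v : Fin (k + 1) → E} (hv : v 0 ∈ (e.extend I).target) :
    IsCurve I (fun t => (e.extend I).symm (polyCurve v t)) := by
  have hp : ContDiff ℝ ∞ (polyCurve v) :=
    contDiff_polyCurve.comp (contDiff_const.prodMk contDiff_id)
  refine IsCurve.comp (I := 𝓘(ℝ, E)) (F := (e.extend I).symm) (c := polyCurve v)
    (Eventually.of_forall fun t => hp.contDiffAt.contMDiffAt) ?_
  rw [polyCurve_zero]
  filter_upwards [e.isOpen_extend_target.mem_nhds hv] with y hy
  exact contMDiffAt_extend_symm he hy

lemma extend_symm_mem {e : OpenPartialHomeomorph M H} {y : E} (hy : y ∈ (e.extend I).target) :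
    (e.extend I).symm y ∈ e.source := by
  have := (e.extend I).map_target hy
  rwa [e.extend_source] at this

/-- The chart of `T⁽ᵏ⁾M` induced by a chart of `M`. -/
def jetChart (I : ModelWithCorners ℝ E H) [IsManifold I ∞ M] [I.Boundaryless] (k : ℕ)
    (e : atlas H M) : PartialEquiv (JetBundle I k M) (Fin (k + 1) → E) where
  toFun := jetCoord e.1
  invFun v := jet I k (fun t => (e.1.extend I).symm (polyCurve v t))
  source := {z | z.base ∈ e.1.source}
  target := {v | v 0 ∈ (e.1.extend I).target}
  map_source' z hz := by
    have h : jetCoord e.1 z 0 = e.1.extend I z.base := by simp [jetCoord, JetBundle.base]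
    simp only [mem_ofPred_eq, h]
    exact (e.1.extend I).map_source (by rwa [e.1.extend_source])
  map_target' v hv := by
    simp only [mem_ofPred_eq, jet_base (isCurve_symm_polyCurve e.2 hv), polyCurve_zero]
    exact extend_symm_mem hv
  left_inv' z hz := by
    have h : jetCoord e.1 z 0 = e.1.extend I z.base := by simp [jetCoord, JetBundle.base]
    have ht : jetCoord e.1 z 0 ∈ (e.1.extend I).target := by
      rw [h]
      exact (e.1.extend I).map_source (by rwa [e.1.extend_source])
    have hc := isCurve_symm_polyCurve e.2 ht
    have h0 : (e.1.extend I).symm (polyCurve (jetCoord e.1 z) 0) = z.rep 0 := by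
      rw [polyCurve_zero, h]
      exact e.1.extend_left_inv hz
    conv_rhs => rw [← jet_rep z]
    rw [jet_eq_jet_iff e.2 hc z.isCurve_rep (by rw [h0]; exact hz)]
    refine ⟨h0, fun i hi => ?_⟩
    have hev : e.1.extend I ∘ (fun t => (e.1.extend I).symm (polyCurve (jetCoord e.1 z) t))
        =ᶠ[𝓝 0] polyCurve (jetCoord e.1 z) := by
      have hcont : ContinuousAt (polyCurve (jetCoord e.1 z)) 0 :=
        (contDiff_polyCurve.comp (contDiff_const.prodMk contDiff_id)).continuous.continuousAt
      filter_upwards [hcont.eventually (e.1.isOpen_extend_target.mem_nhds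
        (by rwa [polyCurve_zero]))] with t ht
      exact (e.1.extend I).right_inv ht
    rw [hev.iteratedDeriv_eq i]
    have := iteratedDeriv_polyCurve (jetCoord e.1 z) ⟨i, Nat.lt_succ_iff.2 hi⟩
    simp only at this
    rw [this, jetCoord, smul_inv_smul₀ (by positivity)]
  right_inv' v hv := by
    have hc := isCurve_symm_polyCurve e.2 hv
    funext r
    rw [jetCoord_jet e.2 hc (by rw [polyCurve_zero]; exact extend_symm_mem hv)]
    have hev : e.1.extend I ∘ (fun t => (e.1.extend I).symm (polyCurve v t))
        =ᶠ[𝓝 0] polyCurve v := by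
      have hcont : ContinuousAt (polyCurve v) 0 :=
        (contDiff_polyCurve.comp (contDiff_const.prodMk contDiff_id)).continuous.continuousAt
      filter_upwards [hcont.eventually (e.1.isOpen_extend_target.mem_nhds
        (by rw [polyCurve_zero]; exact hv))] with t ht
      exact (e.1.extend I).right_inv ht
    rw [hev.iteratedDeriv_eq r, iteratedDeriv_polyCurve, inv_smul_smul₀ (by positivity)]

lemma jetChart_trans_source (e e' : atlas H M) :
    ((jetChart I k e).symm.trans (jetChart I k e')).source =
      {v | v 0 ∈ ((e.1.extend I).symm.trans (e'.1.extend I)).source} := by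
  ext v
  simp only [PartialEquiv.trans_source, PartialEquiv.symm_source, mem_inter_iff, mem_preimage,
    mem_ofPred_eq, e'.1.extend_source]
  refine and_congr_right fun hv => ?_
  change (jet I k (fun t => (e.1.extend I).symm (polyCurve v t))).base ∈ e'.1.source ↔ _
  rw [jet_base (isCurve_symm_polyCurve e.2 hv), polyCurve_zero]

lemma isOpen_extend_trans_source (e e' : atlas H M) :
    IsOpen ((e.1.extend I).symm.trans (e'.1.extend I)).source := by
  rw [PartialEquiv.trans_source, PartialEquiv.symm_source, e'.1.extend_source]
  refine ContinuousOn.isOpen_inter_preimage ?_ e.1.isOpen_extend_target e'.1.open_source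
  exact e.1.continuousOn_extend_symm

lemma contDiffOn_jetChart_trans (e e' : atlas H M) :
    ContDiffOn ℝ ∞ ((jetChart I k e).symm.trans (jetChart I k e'))
      ((jetChart I k e).symm.trans (jetChart I k e')).source := by
  rw [jetChart_trans_source]
  have hS := isOpen_extend_trans_source (I := I) e e'
  set S := ((e.1.extend I).symm.trans (e'.1.extend I)).source with hSdef
  have hφ : ContDiffOn ℝ ∞ (e'.1.extend I ∘ (e.1.extend I).symm) S :=
    I.contDiffOn_extendCoordChange (IsManifold.subset_maximalAtlas e.2)
      (IsManifold.subset_maximalAtlas e'.2)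
  have hO : IsOpen {p : (Fin (k + 1) → E) × ℝ | polyCurve p.1 p.2 ∈ S} :=
    hS.preimage contDiff_polyCurve.continuous
  have hF : ContDiffOn ℝ ∞ (fun p : (Fin (k + 1) → E) × ℝ =>
      (e'.1.extend I ∘ (e.1.extend I).symm) (polyCurve p.1 p.2))
      {p | polyCurve p.1 p.2 ∈ S} :=
    hφ.comp contDiff_polyCurve.contDiffOn fun p hp => hp
  rw [contDiffOn_pi]
  intro r
  have h1 := contDiffOn_iteratedDeriv_snd hO hF r
  have h2 : ContDiffOn ℝ ∞ (fun v : Fin (k + 1) → E => ((r : ℕ).factorial : ℝ)⁻¹ •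
      iteratedDeriv r (fun s => (e'.1.extend I ∘ (e.1.extend I).symm) (polyCurve v s)) 0)
      {v | v 0 ∈ S} := by
    refine ContDiffOn.const_smul _ ?_
    exact h1.comp (f := fun v : Fin (k + 1) → E => (v, (0 : ℝ)))
      (contDiff_id.prodMk contDiff_const).contDiffOn
      fun v hv => by simpa [polyCurve_zero] using hv
  refine h2.congr fun v hv => ?_
  have hv' : v 0 ∈ (e.1.extend I).target := hv.1
  have hv'' : (e.1.extend I).symm (v 0) ∈ e'.1.source := by
    have := hv.2
    rwa [mem_preimage, e'.1.extend_source] at this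
  exact jetCoord_jet e'.2 (isCurve_symm_polyCurve e.2 hv') (by rwa [polyCurve_zero]) r

/-- The atlas of `T⁽ᵏ⁾M` formed by the charts induced by the charts of `M`. -/
def jetCore (I : ModelWithCorners ℝ E H) (k : ℕ) (M : Type*) [TopologicalSpace M]
    [ChartedSpace H M] [IsManifold I ∞ M] [I.Boundaryless] :
    ChartedSpaceCore (Fin (k + 1) → E) (JetBundle I k M) where
  atlas := range (jetChart I k)
  chartAt z := jetChart I k (achart H z.base)
  mem_chart_source z := mem_chart_source H z.base
  chart_mem_atlas z := mem_range_self _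
  open_source := by
    rintro _ _ ⟨e, rfl⟩ ⟨e', rfl⟩
    rw [jetChart_trans_source]
    exact (isOpen_extend_trans_source e e').preimage (continuous_apply 0)
  continuousOn_toFun := by
    rintro _ _ ⟨e, rfl⟩ ⟨e', rfl⟩
    exact (contDiffOn_jetChart_trans e e').continuousOn

instance JetBundle.topologicalSpace : TopologicalSpace (JetBundle I k M) := (jetCore I k M).toTopologicalSpace

instance JetBundle.chartedSpace : ChartedSpace (Fin (k + 1) → E) (JetBundle I k M) := (jetCore I k M).toChartedSpace

/-- The model of `T⁽ᵏ⁾M`: the normed space of the coordinates `(q, q⁽¹⁾, …, q⁽ᵏ⁾)`. -/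
abbrev jetModel (E : Type*) [NormedAddCommGroup E] [NormedSpace ℝ E] (k : ℕ) :
    ModelWithCorners ℝ (Fin (k + 1) → E) (Fin (k + 1) → E) :=
  𝓘(ℝ, Fin (k + 1) → E)

instance JetBundle.isManifold : IsManifold (jetModel E k) ∞ (JetBundle I k M) := by
  refine isManifold_of_contDiffOn _ _ _ fun e e' he he' => ?_
  obtain ⟨_, ⟨e₀, rfl⟩, rfl⟩ := mem_iUnion₂.1 he
  obtain ⟨_, ⟨e₀', rfl⟩, rfl⟩ := mem_iUnion₂.1 he'
  have h := contDiffOn_jetChart_trans (I := I) (k := k) e₀ e₀'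
  exact ContDiffOn.mono h inter_subset_left

end JetManifold

section Identification

variable {E H M : Type*} [NormedAddCommGroup E] [NormedSpace ℝ E] [TopologicalSpace H]
  [TopologicalSpace M] [ChartedSpace H M]

/-- The tangent vector `j₀⁽¹⁾γ = γ'(0)` of a curve. -/
def velocity (I : ModelWithCorners ℝ E H) (γ : ℝ → M) : TangentBundle I M :=
  ⟨γ 0, mfderiv 𝓘(ℝ, ℝ) I γ 0 (1 : ℝ)⟩

variable {I : ModelWithCorners ℝ E H}

lemma hasDerivAt_of_velocity_eq [I.Boundaryless] {γ : ℝ → M} {X : TangentBundle I M}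
    (hγ : MDifferentiableAt 𝓘(ℝ, ℝ) I γ 0) (h : velocity I γ = X) :
    HasDerivAt (extChartAt I X.1 ∘ γ) X.2 0 := by
  subst h
  obtain ⟨L, h2, hL⟩ : ∃ L : ℝ →L[ℝ] E, HasFDerivWithinAt (extChartAt I (γ 0) ∘ γ) L
      (range 𝓘(ℝ, ℝ)) 0 ∧ L 1 = (velocity I γ).2 := ⟨_, hγ.hasMFDerivAt.2, rfl⟩
  rw [ModelWithCorners.range_eq_univ, hasFDerivWithinAt_univ] at h2
  rw [← hL]
  exact h2.hasDerivAt

lemma velocity_eq_of_hasDerivAt [I.Boundaryless] {γ : ℝ → M} {X : TangentBundle I M}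
    (hγ : ContinuousAt γ 0) (h0 : γ 0 = X.1)
    (h : HasDerivAt (extChartAt I X.1 ∘ γ) X.2 0) : velocity I γ = X := by
  obtain ⟨x, v⟩ := X
  simp only at h0 h
  subst h0
  have hm : HasMFDerivAt 𝓘(ℝ, ℝ) I γ 0
      (ContinuousLinearMap.toSpanSingleton ℝ (v : E) : ℝ →L[ℝ] E) := by
    have h2 : HasFDerivWithinAt (extChartAt I (γ 0) ∘ γ)
        (ContinuousLinearMap.toSpanSingleton ℝ (v : E)) (range 𝓘(ℝ, ℝ)) 0 :=
      h.hasFDerivAt.hasFDerivWithinAt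
    exact ⟨hγ, h2⟩
  simp only [velocity, hm.mfderiv]
  congr 1
  exact one_smul ℝ (v : E)

/-- `c (t, s)` is a smooth two-parameter family of points, defined around `(0, 0)`. -/
def IsFamily (I : ModelWithCorners ℝ E H) (c : ℝ × ℝ → M) : Prop :=
  ∀ᶠ p in 𝓝 (0 : ℝ × ℝ), ContMDiffAt 𝓘(ℝ, ℝ × ℝ) I ∞ c p

variable [IsManifold I ∞ M] [I.Boundaryless] {k : ℕ}

/-- Every tangent vector of `T⁽ᵏ⁾M` is of the form `j₀⁽¹⁾(t ↦ j₀⁽ᵏ⁾ c(t, ·))`. -/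
lemma exists_family (X : TangentBundle (jetModel E k) (JetBundle I k M)) :
    ∃ c : ℝ × ℝ → M, IsFamily I c ∧
      velocity (jetModel E k) (fun t => jet I k (fun s => c (t, s))) = X := by
  set e : atlas H M := achart H X.1.base
  set a : Fin (k + 1) → E := jetChart I k e X.1
  let b : Fin (k + 1) → E := X.2
  have hX : X.1 ∈ (jetChart I k e).source := mem_chart_source H X.1.base
  have ha : a ∈ (jetChart I k e).target := (jetChart I k e).map_source hX
  have hline : Continuous fun t : ℝ => a + t • b := by fun_prop
  have hev : ∀ᶠ t in 𝓝 (0 : ℝ), a + t • b ∈ (jetChart I k e).target := by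
    refine hline.continuousAt.eventually (IsOpen.mem_nhds ?_ (by simpa using ha))
    exact (e.1.isOpen_extend_target (I := I)).preimage
      (continuous_apply (A := fun _ : Fin (k + 1) => E) 0)
  refine ⟨fun p => (e.1.extend I).symm (polyCurve (a + p.1 • b) p.2), ?_, ?_⟩
  · have hp : ContDiff ℝ ∞ fun p : ℝ × ℝ => polyCurve (a + p.1 • b) p.2 :=
      contDiff_polyCurve.comp (f := fun p : ℝ × ℝ => (a + p.1 • b, p.2)) (by fun_prop)
    have h0 : polyCurve (a + (0 : ℝ × ℝ).1 • b) (0 : ℝ × ℝ).2 ∈ (e.1.extend I).target := by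
      have h : a + (0 : ℝ) • b = a := by simp
      simp only [Prod.fst_zero, Prod.snd_zero, polyCurve_zero, h]
      exact ha
    filter_upwards [hp.continuous.continuousAt.eventually
      (e.1.isOpen_extend_target.mem_nhds h0)] with p hpt
    exact (contMDiffAt_extend_symm e.2 hpt).comp p hp.contDiffAt.contMDiffAt
  · let J : OpenPartialHomeomorph (JetBundle I k M) (Fin (k + 1) → E) :=
      chartAt (Fin (k + 1) → E) X.1
    have hJ : ∀ z, J z = jetChart I k e z := fun _ => rfl
    have hcont : ContinuousAt (fun t : ℝ => J.symm (a + t • b)) 0 := by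
      refine ContinuousAt.comp (g := J.symm) (f := fun t : ℝ => a + t • b) ?_ hline.continuousAt
      refine J.continuousAt_symm ?_
      exact hev.self_of_nhds
    refine velocity_eq_of_hasDerivAt hcont ?_ ?_
    · have h : a + (0 : ℝ) • b = a := by simp
      simp only [h]
      exact (jetChart I k e).left_inv hX
    · have h1 : HasDerivAt (fun t : ℝ => a + t • b) b 0 := by
        simpa using ((hasDerivAt_id (0 : ℝ)).smul_const b).const_add a
      refine h1.congr_of_eventuallyEq ?_
      filter_upwards [hev] with t ht
      exact (jetChart I k e).right_inv ht

/-- The canonical identification `Φ⁽ᵏ⁾ : T(T⁽ᵏ⁾M) → T⁽ᵏ⁾(TM)`: if `X = j₀⁽¹⁾(t ↦ j₀⁽ᵏ⁾(s ↦ c(t, s)))`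
then `Φ⁽ᵏ⁾ X = j₀⁽ᵏ⁾(s ↦ j₀⁽¹⁾(t ↦ c(t, s)))`; see `canonicalFlip_velocity_jet` for the independence
of the family `c`. -/
def canonicalFlip (I : ModelWithCorners ℝ E H) [IsManifold I ∞ M] [I.Boundaryless] (k : ℕ)
    (X : TangentBundle (jetModel E k) (JetBundle I k M)) :
    JetBundle I.tangent k (TangentBundle I M) :=
  jet I.tangent k (fun s => velocity I (fun t => (exists_family X).choose (t, s)))

/-- The velocity of a curve in the chart of the tangent bundle induced by the chart at `q`. -/
lemma extChartAt_velocity (w : TangentBundle I M) {γ : ℝ → M}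
    (hγ : MDifferentiableAt 𝓘(ℝ, ℝ) I γ 0) (hs : γ 0 ∈ (chartAt H w.1).source) :
    extChartAt I.tangent w (velocity I γ) =
      (extChartAt I w.1 (γ 0), deriv (extChartAt I w.1 ∘ γ) 0) := by
  have h1 := hasDerivAt_of_velocity_eq hγ rfl
  have h2 := hasFDerivWithinAt_tangentCoordChange (I := I) (x := γ 0) (y := w.1) (z := γ 0)
    ⟨mem_extChartAt_source _, by rwa [extChartAt_source]⟩
  rw [I.range_eq_univ, hasFDerivWithinAt_univ] at h2
  have h3 := h2.comp_hasDerivAt (0 : ℝ) h1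
  have h4 : (extChartAt I w.1 ∘ (extChartAt I (γ 0)).symm) ∘ extChartAt I (γ 0) ∘ γ
      =ᶠ[𝓝 0] extChartAt I w.1 ∘ γ := by
    filter_upwards [hγ.continuousAt.eventually ((chartAt H (γ 0)).open_source.mem_nhds
      (mem_chart_source H _))] with t ht
    simp only [Function.comp_apply]
    rw [(extChartAt I (γ 0)).left_inv (by rwa [extChartAt_source])]
  have h5 := (h3.congr_of_eventuallyEq h4.symm).deriv
  rw [h5]
  rfl

lemma IsFamily.exists_open {c : ℝ × ℝ → M} (hc : IsFamily I c) {q : M}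
    (hq : c 0 ∈ (chartAt H q).source) :
    ∃ O : Set (ℝ × ℝ), IsOpen O ∧ 0 ∈ O ∧ (∀ p ∈ O, ContMDiffAt 𝓘(ℝ, ℝ × ℝ) I ∞ c p) ∧
      (∀ p ∈ O, c p ∈ (chartAt H q).source) ∧ ContDiffOn ℝ ∞ (extChartAt I q ∘ c) O := by
  have h := hc.and (hc.self_of_nhds.continuousAt.eventually
    ((chartAt H q).open_source.mem_nhds hq))
  obtain ⟨O, hO, hOo, h0⟩ := eventually_nhds_iff.1 h
  refine ⟨O, hOo, h0, fun p hp => (hO p hp).1, fun p hp => (hO p hp).2, fun p hp => ?_⟩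
  exact ((contMDiffAt_extChartAt' (hO p hp).2).comp p (hO p hp).1).contDiffAt.contDiffWithinAt

lemma mdifferentiableAt_of_family {c : ℝ × ℝ → M} {s : ℝ}
    (h : ContMDiffAt 𝓘(ℝ, ℝ × ℝ) I ∞ c (0, s)) :
    MDifferentiableAt 𝓘(ℝ, ℝ) I (fun t => c (t, s)) 0 := by
  have h1 : ContMDiffAt 𝓘(ℝ, ℝ) 𝓘(ℝ, ℝ × ℝ) ∞ (fun t : ℝ => ((t, s) : ℝ × ℝ)) 0 :=
    (contDiff_id.prodMk contDiff_const).contDiffAt.contMDiffAt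
  exact (ContMDiffAt.comp (0 : ℝ) (g := c) h h1).mdifferentiableAt (by simp)

/-- The curve `s ↦ j₀⁽¹⁾(t ↦ c(t, s))` in a chart of the tangent bundle. -/
lemma IsFamily.velocity_chart {c : ℝ × ℝ → M} (hc : IsFamily I c) (w : TangentBundle I M)
    (hq : c 0 ∈ (chartAt H w.1).source) :
    extChartAt I.tangent w ∘ (fun s => velocity I (fun t => c (t, s))) =ᶠ[𝓝 0]
      fun s => (extChartAt I w.1 (c (0, s)), deriv (fun t => extChartAt I w.1 (c (t, s))) 0) := by
  obtain ⟨O, hO, h0, hsm, hsrc, -⟩ := hc.exists_open hq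
  have hcont : ContinuousAt (fun s : ℝ => ((0, s) : ℝ × ℝ)) 0 := by fun_prop
  filter_upwards [hcont.eventually (hO.mem_nhds h0)] with s hs
  exact extChartAt_velocity w (mdifferentiableAt_of_family (hsm _ hs)) (hsrc _ hs)

lemma IsFamily.contDiffAt_chart {c : ℝ × ℝ → M} (hc : IsFamily I c) {q : M}
    (hq : c 0 ∈ (chartAt H q).source) : ∀ᶠ s in 𝓝 (0 : ℝ),
      ContDiffAt ℝ ∞ (fun s => extChartAt I q (c (0, s))) s ∧
      ContDiffAt ℝ ∞ (fun s => deriv (fun t => extChartAt I q (c (t, s))) 0) s := by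
  obtain ⟨O, hO, h0, -, -, hf⟩ := hc.exists_open hq
  have hcont : ContinuousAt (fun s : ℝ => ((0, s) : ℝ × ℝ)) 0 := by fun_prop
  have hi : ContDiff ℝ ∞ (fun s : ℝ => ((0, s) : ℝ × ℝ)) := contDiff_const.prodMk contDiff_id
  filter_upwards [hcont.eventually (hO.mem_nhds h0)] with s hs
  exact ⟨(hf.contDiffAt (hO.mem_nhds hs)).comp s hi.contDiffAt,
    ((contDiffOn_deriv_fst hO hf).contDiffAt (hO.mem_nhds hs)).comp s hi.contDiffAt⟩

lemma IsFamily.isCurve_velocity {c : ℝ × ℝ → M} (hc : IsFamily I c) :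
    IsCurve I.tangent (fun s => velocity I (fun t => c (t, s))) := by
  let w : TangentBundle I M := ⟨c 0, 0⟩
  have hq : c 0 ∈ (chartAt H w.1).source := mem_chart_source H _
  obtain ⟨O, hO, h0, hsm, hsrc, -⟩ := hc.exists_open hq
  have hcont : ContinuousAt (fun s : ℝ => ((0, s) : ℝ × ℝ)) 0 := by fun_prop
  have hmem : ∀ᶠ s in 𝓝 (0 : ℝ), velocity I (fun t => c (t, s)) ∈
      (extChartAt I.tangent w).source := by
    filter_upwards [hcont.eventually (hO.mem_nhds h0)] with s hs
    rw [extChartAt_source, TangentBundle.mem_chart_source_iff]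
    exact hsrc _ hs
  have hchart := hc.velocity_chart w hq
  have hev : (fun s => (extChartAt I.tangent w).symm
      (extChartAt I w.1 (c (0, s)), deriv (fun t => extChartAt I w.1 (c (t, s))) 0))
      =ᶠ[𝓝 0] (fun s => velocity I (fun t => c (t, s))) := by
    filter_upwards [hmem, hchart] with s hs hs'
    rw [← hs']
    exact (extChartAt I.tangent w).left_inv hs
  refine IsCurve.congr ?_ hev
  filter_upwards [hmem, hchart, hc.contDiffAt_chart hq] with s hs hs' hd
  have ht : (extChartAt I w.1 (c (0, s)), deriv (fun t => extChartAt I w.1 (c (t, s))) 0) ∈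
      (extChartAt I.tangent w).target := by
    rw [← hs']
    exact (extChartAt I.tangent w).map_source hs
  have h1 := contMDiffAt_extend_symm (I := I.tangent) (chart_mem_atlas (ModelProd H E) w) ht
  exact ContMDiffAt.comp s h1 (hd.1.prodMk hd.2).contMDiffAt

/-- The jets `j₀⁽ᵏ⁾ c(t, ·)` in a chart. -/
lemma IsFamily.jetCoord_eventually {c : ℝ × ℝ → M} (hc : IsFamily I c) {q : M}
    (hq : c 0 ∈ (chartAt H q).source) :
    ∀ᶠ t in 𝓝 (0 : ℝ), IsCurve I (fun s => c (t, s)) ∧ c (t, 0) ∈ (chartAt H q).source ∧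
      ∀ r : Fin (k + 1), jetCoord (chartAt H q) (jet I k (fun s => c (t, s))) r =
      ((r : ℕ).factorial : ℝ)⁻¹ • iteratedDeriv r (fun s => (extChartAt I q ∘ c) (t, s)) 0 := by
  obtain ⟨O, hO, h0, hsm, hsrc, -⟩ := hc.exists_open hq
  have hcont : ContinuousAt (fun t : ℝ => ((t, 0) : ℝ × ℝ)) 0 := by fun_prop
  filter_upwards [hcont.eventually (hO.mem_nhds h0)] with t ht
  have hcurve : IsCurve I (fun s => c (t, s)) := by
    have hcont : ContinuousAt (fun s : ℝ => ((t, s) : ℝ × ℝ)) 0 := by fun_prop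
    filter_upwards [hcont.eventually (hO.mem_nhds ht)] with s hs
    have h1 : ContMDiffAt 𝓘(ℝ, ℝ) 𝓘(ℝ, ℝ × ℝ) ∞ (fun s : ℝ => ((t, s) : ℝ × ℝ)) s :=
      (contDiff_const.prodMk contDiff_id).contDiffAt.contMDiffAt
    exact ContMDiffAt.comp s (g := c) (hsm _ hs) h1
  exact ⟨hcurve, hsrc _ ht, fun r => jetCoord_jet (chart_mem_atlas H q) hcurve (hsrc _ ht) r⟩

lemma IsFamily.hasDerivAt_jet {c : ℝ × ℝ → M} (hc : IsFamily I c)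
    {X : TangentBundle (jetModel E k) (JetBundle I k M)}
    (hX : velocity (jetModel E k) (fun t => jet I k (fun s => c (t, s))) = X) :
    c 0 = X.1.base ∧ ∀ r : Fin (k + 1),
      iteratedDeriv r (fun s => extChartAt I X.1.base (c (0, s))) 0 =
        ((r : ℕ).factorial : ℝ) • jetCoord (chartAt H X.1.base) X.1 r ∧
      iteratedDeriv r (fun s => deriv (fun t => extChartAt I X.1.base (c (t, s))) 0) 0 =
        ((r : ℕ).factorial : ℝ) • (X.2 : Fin (k + 1) → E) r := by
  have hz : jet I k (fun s => c (0, s)) = X.1 := congrArg TotalSpace.proj hX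
  have hcurve : IsCurve I (fun s => c (0, s)) :=
    (hc.jetCoord_eventually (k := k) (mem_chart_source H (c 0))).self_of_nhds.1
  have hbase : c 0 = X.1.base := by rw [← hz, jet_base hcurve]; rfl
  have hq : c 0 ∈ (chartAt H X.1.base).source := hbase ▸ mem_chart_source H (c 0)
  have hco := hc.jetCoord_eventually (k := k) hq
  obtain ⟨O, hO, h0, hsm, hsrc, hf⟩ := hc.exists_open hq
  -- the curve of jets is differentiable
  have hcoord : ∀ r : Fin (k + 1), ContDiffAt ℝ ∞ (fun t : ℝ => ((r : ℕ).factorial : ℝ)⁻¹ •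
      iteratedDeriv r (fun s => (extChartAt I X.1.base ∘ c) (t, s)) 0) 0 := fun r => by
    have h1 := ((contDiffOn_iteratedDeriv_snd hO hf r).contDiffAt (hO.mem_nhds h0))
    exact (ContDiffAt.comp (0 : ℝ) (f := fun t : ℝ => ((t, 0) : ℝ × ℝ)) h1
      (contDiff_id.prodMk contDiff_const).contDiffAt).const_smul _
  have hev : (fun t => jetChart I k (achart H X.1.base) (jet I k (fun s => c (t, s)))) =ᶠ[𝓝 0]
      fun t r => ((r : ℕ).factorial : ℝ)⁻¹ •
        iteratedDeriv r (fun s => (extChartAt I X.1.base ∘ c) (t, s)) 0 := by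
    filter_upwards [hco] with t ht
    funext r
    exact ht.2.2 r
  have hsm' : ContDiffAt ℝ ∞
      (fun t => jetChart I k (achart H X.1.base) (jet I k (fun s => c (t, s)))) 0 :=
    (contDiffAt_pi.2 hcoord).congr_of_eventuallyEq hev
  have hmem : ∀ᶠ t in 𝓝 (0 : ℝ), jet I k (fun s => c (t, s)) ∈
      (chartAt (Fin (k + 1) → E) X.1).source := by
    filter_upwards [hco] with t ht
    change (jet I k (fun s => c (t, s))).base ∈ (chartAt H X.1.base).source
    rw [jet_base ht.1]
    exact ht.2.1
  have hcont : ContinuousAt (fun t => jet I k (fun s => c (t, s))) 0 := by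
    have h1 : ContinuousAt ((chartAt (Fin (k + 1) → E) X.1).symm ∘
        (fun t => jetChart I k (achart H X.1.base) (jet I k (fun s => c (t, s))))) 0 := by
      refine ContinuousAt.comp ?_ hsm'.continuousAt
      exact (chartAt (Fin (k + 1) → E) X.1).continuousAt_symm
        ((chartAt (Fin (k + 1) → E) X.1).map_source hmem.self_of_nhds)
    refine h1.congr ?_
    filter_upwards [hmem] with t ht
    exact (chartAt (Fin (k + 1) → E) X.1).left_inv ht
  have hmd : MDifferentiableAt 𝓘(ℝ, ℝ) (jetModel E k)
      (fun t => jet I k (fun s => c (t, s))) 0 := by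
    have h1 : ContMDiffAt 𝓘(ℝ, ℝ) (jetModel E k) ∞ (fun t => jet I k (fun s => c (t, s))) 0 :=
      (contMDiffAt_iff_target_of_mem_source
        (f := fun t => jet I k (fun s => c (t, s))) hmem.self_of_nhds).2 ⟨hcont, hsm'.contMDiffAt⟩
    exact h1.mdifferentiableAt (by simp)
  have hder : HasDerivAt
      (fun t => jetChart I k (achart H X.1.base) (jet I k (fun s => c (t, s)))) X.2 0 :=
    hasDerivAt_of_velocity_eq hmd hX
  refine ⟨hbase, fun r => ⟨?_, ?_⟩⟩
  · have h1 := hco.self_of_nhds.2.2 r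
    rw [hz] at h1
    rw [h1, smul_inv_smul₀ (by positivity)]
    rfl
  · have h1 := (hasDerivAt_pi.1 (hder.congr_of_eventuallyEq hev.symm)) r
    have h2 := deriv_iteratedDeriv_swap hO hf r h0
    have h3 := h1.deriv
    have hd : DifferentiableAt ℝ (fun t : ℝ =>
        iteratedDeriv r (fun s => (extChartAt I X.1.base ∘ c) (t, s)) 0) 0 := by
      have h4 := ((hcoord r).differentiableAt (by simp)).const_smul (((r : ℕ).factorial : ℝ))
      refine h4.congr_of_eventuallyEq (Eventually.of_forall fun t => ?_)
      exact (smul_inv_smul₀ (show ((r : ℕ).factorial : ℝ) ≠ 0 by positivity) _).symm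
    rw [deriv_fun_const_smul _ hd] at h3
    rw [← h3, smul_inv_smul₀ (by positivity)]
    exact h2.symm

/-- `Φ⁽ᵏ⁾` does not depend on the choice of the representing family. -/
lemma canonicalFlip_velocity_jet {c : ℝ × ℝ → M} (hc : IsFamily I c) :
    canonicalFlip I k (velocity (jetModel E k) (fun t => jet I k (fun s => c (t, s)))) =
      jet I.tangent k (fun s => velocity I (fun t => c (t, s))) := by
  set X := velocity (jetModel E k) (fun t => jet I k (fun s => c (t, s))) with hX
  obtain ⟨hc', hX'⟩ := (exists_family X).choose_spec
  rw [canonicalFlip]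
  set c' := (exists_family X).choose
  let w : TangentBundle I M := ⟨X.1.base, 0⟩
  obtain ⟨hb, hr⟩ := hc.hasDerivAt_jet hX.symm
  obtain ⟨hb', hr'⟩ := hc'.hasDerivAt_jet hX'
  have hq : c 0 ∈ (chartAt H w.1).source := by rw [hb]; exact mem_chart_source H _
  have hq' : c' 0 ∈ (chartAt H w.1).source := by rw [hb']; exact mem_chart_source H _
  have hs : velocity I (fun t => c (t, 0)) ∈ (chartAt (ModelProd H E) w).source := by
    rw [TangentBundle.mem_chart_source_iff]; exact hq
  have hs' : velocity I (fun t => c' (t, 0)) ∈ (chartAt (ModelProd H E) w).source := by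
    rw [TangentBundle.mem_chart_source_iff]; exact hq'
  have key : ∀ i ≤ k,
      iteratedDeriv i (extChartAt I.tangent w ∘ (fun s => velocity I (fun t => c' (t, s)))) 0 =
      iteratedDeriv i (extChartAt I.tangent w ∘ (fun s => velocity I (fun t => c (t, s)))) 0 := by
    intro i hi
    rw [(hc'.velocity_chart w hq').iteratedDeriv_eq i, (hc.velocity_chart w hq).iteratedDeriv_eq i,
      iteratedDeriv_prodMk (hc'.contDiffAt_chart hq').self_of_nhds.1
        (hc'.contDiffAt_chart hq').self_of_nhds.2,
      iteratedDeriv_prodMk (hc.contDiffAt_chart hq).self_of_nhds.1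
        (hc.contDiffAt_chart hq).self_of_nhds.2]
    have e1 := hr ⟨i, Nat.lt_succ_iff.2 hi⟩
    have e2 := hr' ⟨i, Nat.lt_succ_iff.2 hi⟩
    exact Prod.ext (e2.1.trans e1.1.symm) (e2.2.trans e1.2.symm)
  refine (jet_eq_jet_iff (I := I.tangent) (chart_mem_atlas (ModelProd H E) w)
    hc'.isCurve_velocity hc.isCurve_velocity hs').2 ⟨?_, key⟩
  have h0 := key 0 (Nat.zero_le _)
  simp only [iteratedDeriv_zero, Function.comp_apply] at h0
  exact (extChartAt I.tangent w).injOn (by rwa [extChartAt_source]) (by rwa [extChartAt_source]) h0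

end Identification

section Discretization

variable {E H M : Type*} [NormedAddCommGroup E] [NormedSpace ℝ E] [TopologicalSpace H]
  [TopologicalSpace M] [ChartedSpace H M]

/-- The derivative at `0_q` of the restriction of `F : TM → M` to the fibre `T_q M`. The fibre is the
vector space `E`, so the source `T_{0_q} T_q M` is `E` too, and the target `T_{F(0_q)} M`
is `T_q M` whenever `F(0_q) = q`; Mathlib represents each of these tangent spaces by `E`. -/
def fibreDeriv (I : ModelWithCorners ℝ E H) (F : TangentBundle I M → M) (q : M) : E →L[ℝ] E :=
  mfderiv 𝓘(ℝ, E) I (fun u : E => F ⟨q, u⟩) 0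

/-- `R : U → M × M` is a discretization map on `M`, where `U` is an open neighbourhood of the zero
section of `TM` (the values of `R` outside `U` are irrelevant). -/
structure IsDiscretizationMap (I : ModelWithCorners ℝ E H) [IsManifold I ∞ M]
    (U : Set (TangentBundle I M)) (R : TangentBundle I M → M × M) : Prop where
  isOpen : IsOpen U
  zero_mem : ∀ q : M, (⟨q, 0⟩ : TangentBundle I M) ∈ U
  smooth : ContMDiffOn I.tangent (I.prod I) ∞ R U
  map_zero : ∀ q : M, R ⟨q, 0⟩ = (q, q)
  rigid : ∀ q : M, fibreDeriv I (fun w => (R w).2) q - fibreDeriv I (fun w => (R w).1) q =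
    ContinuousLinearMap.id ℝ E

/-- The canonical identification `T⁽ᵏ⁾(M × M) → T⁽ᵏ⁾M × T⁽ᵏ⁾M`. -/
def jetProd (I : ModelWithCorners ℝ E H) (k : ℕ) (z : JetBundle (I.prod I) k (M × M)) :
    JetBundle I k M × JetBundle I k M :=
  (jetMap (I.prod I) I k Prod.fst z, jetMap (I.prod I) I k Prod.snd z)

variable (I : ModelWithCorners ℝ E H) [IsManifold I ∞ M] [I.Boundaryless] (k : ℕ)

/-- The domain `(Φ⁽ᵏ⁾)⁻¹(T⁽ᵏ⁾U)` of the lift of a map defined on the open set `U ⊆ TM`, where `T⁽ᵏ⁾U`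
consists of the jets of curves that pass through `U` at time `0`. -/
def liftDomain (U : Set (TangentBundle I M)) :
    Set (TangentBundle (jetModel E k) (JetBundle I k M)) :=
  {X | (canonicalFlip I k X).base ∈ U}

lemma liftDomain_univ : liftDomain I k (univ : Set (TangentBundle I M)) = univ := rfl

/-- The lift `R⁽ᵏ⁾ = T⁽ᵏ⁾R ∘ Φ⁽ᵏ⁾ : T(T⁽ᵏ⁾M) → T⁽ᵏ⁾M × T⁽ᵏ⁾M`. -/
def discretizationLift (R : TangentBundle I M → M × M)
    (X : TangentBundle (jetModel E k) (JetBundle I k M)) : JetBundle I k M × JetBundle I k M :=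
  jetProd I k (jetMap I.tangent (I.prod I) k R (canonicalFlip I k X))

end Discretization

end HigherTangent

end

/-! Everything is read in a chart of `Q`. A point of the jet bundle has as coordinates the Taylor
coefficients `a = (a₀, …, aₖ)` of a curve, with polynomial representative `a(s) = ∑ sʲ aⱼ`. A
tangent vector with coordinates `(a, b)` is the velocity at `t = 0` of the jets of `c(t, s) = ∑ sʲ
(aⱼ + t bⱼ)`. Taking `d/dt` first turns this family into the curve `s ↦ (a(s), b(s))` in `TQ`, so in
coordinates `Φ⁽ᵏ⁾` sends `(a, b)` to the jet of that curve (`canonicalFlip_eq_jet`). The lift of `R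
= (R¹, R²)` at `(a, b)` is therefore the pair of jets of `s ↦ Rⁱ(a(s), b(s))`
(`IsDiscretizationMap.lift_eq_jet`).

The conditions follow from this formula. The vector lies in the domain iff the point with
coordinates `(a₀, b₀)` lies in `U`, which is an open condition. The coordinates of the lift are, up
to factorials, `s`-derivatives at `0` of a function smooth in `(a, b, s)`, so they are smooth in
`(a, b)` (`contMDiffAt_jet`). A zero vector gives a curve in the zero section, which `R` sends to `s
↦ (q(s), q(s))`.

For rigidity, fix `a` and differentiate at `b = 0` in the direction `β`. By symmetry of mixed
partials this derivative commutes with `∂ₛʳ` (`fderiv_jetCoord`). For each small `s`, what remains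
inside is the derivative of `Rⁱ` along the fibre over the point `a(s)` in the direction `β(s)`.
Rigidity of `R` at that point says that the difference over `i = 2, 1` is `β(s)`. This holds in the
one fixed chart for all these points, because `R¹` and `R²` agree on the zero section and both
derivatives transform by the same linear coordinate change (`IsDiscretizationMap.deriv_sub_deriv`).
The coefficient of order `r` of the polynomial `β(s)` is `βᵣ`, so the difference of the derivatives
of the lift is the identity. -/

namespace HigherTangent

/-! ### Jets of curves depending smoothly on a parameter -/

section ParametrizedCurves

variable {E H M V : Type*} [NormedAddCommGroup E] [NormedSpace ℝ E] [TopologicalSpace H]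
  [TopologicalSpace M] [ChartedSpace H M] [NormedAddCommGroup V] [NormedSpace ℝ V]
  {I : ModelWithCorners ℝ E H} [IsManifold I ∞ M] [I.Boundaryless] {k : ℕ}

/-- A smooth family `G (v, ·)` of curves, read in a chart around `G (v₀, 0)`. -/
lemma exists_isOpen_contDiffOn_extend {G : V × ℝ → M} {v₀ : V}
    (hG : ∀ᶠ p in 𝓝 (v₀, (0 : ℝ)), ContMDiffAt 𝓘(ℝ, V × ℝ) I ∞ G p)
    {e : OpenPartialHomeomorph M H} (he : e ∈ atlas H M) (hs : G (v₀, 0) ∈ e.source) :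
    ∃ O : Set (V × ℝ), IsOpen O ∧ (v₀, (0 : ℝ)) ∈ O ∧ ContDiffOn ℝ ∞ (e.extend I ∘ G) O ∧
      ∀ v, (v, (0 : ℝ)) ∈ O → IsCurve I (fun s => G (v, s)) ∧ G (v, 0) ∈ e.source := by
  have h := hG.and (hG.self_of_nhds.continuousAt.eventually (e.open_source.mem_nhds hs))
  obtain ⟨O, hO, hOo, h0⟩ := eventually_nhds_iff.1 h
  refine ⟨O, hOo, h0, fun p hp => ?_, fun v hv => ⟨?_, (hO _ hv).2⟩⟩
  · exact ((contMDiffAt_extend_atlas he (hO p hp).2).comp p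
      (hO p hp).1).contDiffAt.contDiffWithinAt
  · have hcont : ContinuousAt (fun s : ℝ => ((v, s) : V × ℝ)) 0 := by fun_prop
    filter_upwards [hcont.eventually (hOo.mem_nhds hv)] with s hs
    have h1 : ContMDiffAt 𝓘(ℝ, ℝ) 𝓘(ℝ, V × ℝ) ∞ (fun s : ℝ => ((v, s) : V × ℝ)) s :=
      (contDiff_const.prodMk contDiff_id).contDiffAt.contMDiffAt
    exact ContMDiffAt.comp s (g := G) (hO _ hs).1 h1

/-- The jets of a smooth family of curves depend smoothly on the parameter. -/
lemma contMDiffAt_jet {G : V × ℝ → M} {v₀ : V}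
    (hG : ∀ᶠ p in 𝓝 (v₀, (0 : ℝ)), ContMDiffAt 𝓘(ℝ, V × ℝ) I ∞ G p) :
    ContMDiffAt 𝓘(ℝ, V) (jetModel E k) ∞ (fun v => jet I k (fun s => G (v, s))) v₀ := by
  -- The chart of the jet bundle at a jet is by definition induced by the chart of `M` at the base
  -- of that jet, so this base is used rather than `G (v₀, 0)`. Their equality needs smoothness of
  -- the curve, hence the preliminary chart at `G (v₀, 0)`.
  set q := (jet I k (fun s => G (v₀, s))).base
  have hq : q = G (v₀, 0) := by
    obtain ⟨O, -, h0, -, h⟩ := exists_isOpen_contDiffOn_extend hG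
      (chart_mem_atlas H (G (v₀, 0))) (mem_chart_source H _)
    exact jet_base (h _ h0).1
  obtain ⟨O, hO, h0, hf, hc⟩ := exists_isOpen_contDiffOn_extend hG (chart_mem_atlas H q)
    (hq ▸ mem_chart_source H _)
  let J : OpenPartialHomeomorph (JetBundle I k M) (Fin (k + 1) → E) :=
    chartAt (Fin (k + 1) → E) (jet I k (fun s => G (v₀, s)))
  have hcont : ContinuousAt (fun v : V => ((v, 0) : V × ℝ)) v₀ := by fun_prop
  have hev : ∀ᶠ v in 𝓝 v₀, (v, (0 : ℝ)) ∈ O := hcont.eventually (hO.mem_nhds h0)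
  have hmem : ∀ᶠ v in 𝓝 v₀, jet I k (fun s => G (v, s)) ∈ J.source := by
    filter_upwards [hev] with v hv
    change (jet I k (fun s => G (v, s))).base ∈ (chartAt H q).source
    rw [jet_base (hc v hv).1]
    exact (hc v hv).2
  have hsm : ContDiffAt ℝ ∞ (fun v => J (jet I k (fun s => G (v, s)))) v₀ := by
    have hcoord : ContDiffAt ℝ ∞ (fun v : V => fun r : Fin (k + 1) => ((r : ℕ).factorial : ℝ)⁻¹ •
        iteratedDeriv r (fun s => ((chartAt H q).extend I ∘ G) (v, s)) 0) v₀ := by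
      refine contDiffAt_pi.2 fun r => ?_
      have h1 := (contDiffOn_iteratedDeriv_snd hO hf r).contDiffAt (hO.mem_nhds h0)
      exact (ContDiffAt.comp v₀ (f := fun v : V => ((v, 0) : V × ℝ)) h1
        (contDiff_id.prodMk contDiff_const).contDiffAt).const_smul _
    refine hcoord.congr_of_eventuallyEq ?_
    filter_upwards [hev] with v hv
    funext r
    exact jetCoord_jet (chart_mem_atlas H q) (hc v hv).1 (hc v hv).2 r
  -- Smooth coordinates give continuity because the jets stay in the source of `J`, where the map is
  -- `J.symm` of its coordinates.
  have hcont : ContinuousAt (fun v => jet I k (fun s => G (v, s))) v₀ := by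
    have h1 : ContinuousAt (J.symm ∘ (fun v => J (jet I k (fun s => G (v, s))))) v₀ :=
      ContinuousAt.comp (J.continuousAt_symm (J.map_source hmem.self_of_nhds)) hsm.continuousAt
    refine h1.congr ?_
    filter_upwards [hmem] with v hv
    exact J.left_inv hv
  exact (contMDiffAt_iff_target_of_mem_source (f := fun v => jet I k (fun s => G (v, s)))
    hmem.self_of_nhds).2 ⟨hcont, hsm.contMDiffAt⟩

/-- The derivative of the coordinates of the jets of a smooth family of curves, in the direction
`β`. -/
lemma fderiv_jetCoord {G : V × ℝ → M} {v₀ : V}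
    (hG : ∀ᶠ p in 𝓝 (v₀, (0 : ℝ)), ContMDiffAt 𝓘(ℝ, V × ℝ) I ∞ G p)
    {e : OpenPartialHomeomorph M H} (he : e ∈ atlas H M) (hs : G (v₀, 0) ∈ e.source) (β : V)
    (r : Fin (k + 1)) :
    fderiv ℝ (fun v => jetCoord e (jet I k (fun s => G (v, s)))) v₀ β r =
        ((r : ℕ).factorial : ℝ)⁻¹ •
          iteratedDeriv r (fun s => deriv (fun t : ℝ => e.extend I (G (v₀ + t • β, s))) 0) 0 ∧
      ContDiffAt ℝ ∞ (fun s => deriv (fun t : ℝ => e.extend I (G (v₀ + t • β, s))) 0) 0 := by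
  obtain ⟨O, hO, h0, hf, hc⟩ := exists_isOpen_contDiffOn_extend hG he hs
  have hcont : ContinuousAt (fun v : V => ((v, 0) : V × ℝ)) v₀ := by fun_prop
  have hev : (fun v => jetCoord e (jet I k (fun s => G (v, s)))) =ᶠ[𝓝 v₀]
      fun v : V => fun r : Fin (k + 1) => ((r : ℕ).factorial : ℝ)⁻¹ •
        iteratedDeriv r (fun s => (e.extend I ∘ G) (v, s)) 0 := by
    filter_upwards [hcont.eventually (hO.mem_nhds h0)] with v hv
    funext r
    exact jetCoord_jet he (hc v hv).1 (hc v hv).2 r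
  have hd : ∀ r : Fin (k + 1), DifferentiableAt ℝ
      (fun v : V => iteratedDeriv r (fun s => (e.extend I ∘ G) (v, s)) 0) v₀ := fun r => by
    have h1 := (contDiffOn_iteratedDeriv_snd hO hf r).contDiffAt (hO.mem_nhds h0)
    exact (ContDiffAt.comp v₀ (f := fun v : V => ((v, 0) : V × ℝ)) h1
      (contDiff_id.prodMk contDiff_const).contDiffAt).differentiableAt (by simp)
  -- Restricting to the line through `v₀` in the direction `β` turns the directional derivative into
  -- a partial derivative in a real variable `t`, so the symmetry of mixed partials on `ℝ × ℝ`
  -- applies.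
  let ℓ : ℝ × ℝ → V × ℝ := fun p => (v₀ + p.1 • β, p.2)
  have hℓ : ContDiff ℝ ∞ ℓ := by fun_prop
  have hO' : IsOpen (ℓ ⁻¹' O) := hO.preimage hℓ.continuous
  have h0' : (0 : ℝ × ℝ) ∈ ℓ ⁻¹' O := by simpa [ℓ] using h0
  have hf' : ContDiffOn ℝ ∞ ((e.extend I ∘ G) ∘ ℓ) (ℓ ⁻¹' O) :=
    hf.comp hℓ.contDiffOn fun p hp => hp
  refine ⟨?_, ?_⟩
  · have hline : HasDerivAt (fun t : ℝ => v₀ + t • β) β 0 := by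
      simpa using ((hasDerivAt_id (0 : ℝ)).smul_const β).const_add v₀
    have h3 : HasDerivAt (fun t : ℝ =>
        iteratedDeriv r (fun s => (e.extend I ∘ G) (v₀ + t • β, s)) 0)
        (fderiv ℝ (fun v : V => iteratedDeriv r (fun s => (e.extend I ∘ G) (v, s)) 0) v₀ β) 0 := by
      refine HasFDerivAt.comp_hasDerivAt
        (l := fun v : V => iteratedDeriv r (fun s => (e.extend I ∘ G) (v, s)) 0)
        (f := fun t : ℝ => v₀ + t • β) (0 : ℝ) ?_ hline
      simpa using (hd r).hasFDerivAt
    -- The exchange `∂ₜ ∂ₛʳ = ∂ₛʳ ∂ₜ` at the origin, on which the formula rests.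
    have h4 := deriv_iteratedDeriv_swap hO' hf' r h0'
    have h5 : HasFDerivAt (fun v : V => fun r : Fin (k + 1) => ((r : ℕ).factorial : ℝ)⁻¹ •
        iteratedDeriv r (fun s => (e.extend I ∘ G) (v, s)) 0)
        (ContinuousLinearMap.pi fun r : Fin (k + 1) => ((r : ℕ).factorial : ℝ)⁻¹ •
          fderiv ℝ (fun v : V => iteratedDeriv r (fun s => (e.extend I ∘ G) (v, s)) 0) v₀) v₀ :=
      hasFDerivAt_pi.2 fun r => (hd r).hasFDerivAt.const_smul _
    rw [hev.fderiv_eq, h5.fderiv]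
    change ((r : ℕ).factorial : ℝ)⁻¹ • fderiv ℝ
      (fun v : V => iteratedDeriv r (fun s => (e.extend I ∘ G) (v, s)) 0) v₀ β = _
    rw [← h3.deriv]
    exact congrArg _ h4
  · exact ((contDiffOn_deriv_fst hO' hf').contDiffAt (hO'.mem_nhds h0')).comp (0 : ℝ)
      (f := fun s : ℝ => ((0, s) : ℝ × ℝ)) (contDiff_const.prodMk contDiff_id).contDiffAt

end ParametrizedCurves

end HigherTangent

namespace HigherTangent

/-! ### Charts of the tangent bundle and derivatives along fibres -/

section TangentChart

variable {E H M : Type*} [NormedAddCommGroup E] [NormedSpace ℝ E] [TopologicalSpace H]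
  [TopologicalSpace M] [ChartedSpace H M] {I : ModelWithCorners ℝ E H} [IsManifold I ∞ M]
  [I.Boundaryless] {k : ℕ}

lemma extChartAt_tangent_apply (w : TangentBundle I M) (q : M) (u : E) :
    extChartAt I.tangent w (⟨q, u⟩ : TangentBundle I M) =
      (extChartAt I w.1 q, tangentCoordChange I q w.1 q u) := rfl

/-- The inverse of a chart of the tangent bundle is linear on fibres. -/
lemma exists_extChartAt_tangent_symm (w : TangentBundle I M) {y : E}
    (hy : y ∈ (extChartAt I w.1).target) (v : E) :
    ∃ u : E, tangentCoordChange I ((extChartAt I w.1).symm y) w.1 ((extChartAt I w.1).symm y) u = v ∧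
      ∀ t : ℝ, (extChartAt I.tangent w).symm (y, t • v) =
        (⟨(extChartAt I w.1).symm y, t • u⟩ : TangentBundle I M) := by
  set q := (extChartAt I w.1).symm y
  have hq : q ∈ (extChartAt I w.1).source := (extChartAt I w.1).map_target hy
  -- By the cocycle identity the two coordinate changes at `q` are mutually inverse, so the vector
  -- with coordinates `v` in the chart at `w.1` is the transport of `v` back to the chart at `q`.
  have hu : tangentCoordChange I q w.1 q (tangentCoordChange I w.1 q q v) = v := by
    rw [tangentCoordChange_comp ⟨⟨hq, mem_extChartAt_source q⟩, hq⟩, tangentCoordChange_self hq]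
  refine ⟨tangentCoordChange I w.1 q q v, hu, fun t => ?_⟩
  have h : extChartAt I.tangent w
      (⟨q, t • tangentCoordChange I w.1 q q v⟩ : TangentBundle I M) = (y, t • v) := by
    rw [extChartAt_tangent_apply, map_smul, hu]
    exact Prod.ext ((extChartAt I w.1).right_inv hy) rfl
  rw [← h]
  refine (extChartAt I.tangent w).left_inv ?_
  rw [extChartAt_source, TangentBundle.mem_chart_source_iff, ← extChartAt_source I]
  exact hq

lemma mem_extChartAt_tangent_target {w : TangentBundle I M} {y v : E}
    (hy : y ∈ (extChartAt I w.1).target) : (y, v) ∈ (extChartAt I.tangent w).target := by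
  rw [extChartAt_target, mem_inter_iff, mem_preimage, TangentBundle.mem_chart_target_iff,
    ModelWithCorners.range_eq_univ]
  rw [extChartAt_target] at hy
  exact ⟨hy.1, mem_univ _⟩

/-- In the chart of `TM` over the chart at `q` itself, the coordinate change on the fibre is the
identity, so the inclusion of the fibre becomes `u ↦ (const, u)`. -/
lemma contMDiff_fibre (q : M) :
    ContMDiff 𝓘(ℝ, E) I.tangent ∞ (fun u : E => (⟨q, u⟩ : TangentBundle I M)) := by
  intro u
  let w : TangentBundle I M := ⟨q, 0⟩
  have h : (fun u : E => (⟨q, u⟩ : TangentBundle I M)) =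
      fun u : E => (extChartAt I.tangent w).symm (extChartAt I q q, u) := by
    funext u
    have h1 : extChartAt I.tangent w (⟨q, u⟩ : TangentBundle I M) = (extChartAt I q q, u) := by
      rw [extChartAt_tangent_apply, tangentCoordChange_self (mem_extChartAt_source q)]
    rw [← h1, (extChartAt I.tangent w).left_inv]
    rw [extChartAt_source, TangentBundle.mem_chart_source_iff]
    exact mem_chart_source H q
  rw [h]
  have h1 := contMDiffAt_extend_symm (I := I.tangent) (chart_mem_atlas (ModelProd H E) w)
    (mem_extChartAt_tangent_target (w := w) (v := u) (mem_extChartAt_target (I := I) q))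
  exact ContMDiffAt.comp u (f := fun u : E => (extChartAt I q q, u)) h1
    (contDiff_const.prodMk contDiff_id).contDiffAt.contMDiffAt

/-- The manifold derivative is taken in the chart at `F ⟨q, 0⟩`; `h0` identifies it with the chart
at `q`. -/
lemma fibreDeriv_eq_fderiv {F : TangentBundle I M → M} {q : M} (h0 : F ⟨q, 0⟩ = q)
    (hF : MDifferentiableAt 𝓘(ℝ, E) I (fun u : E => F ⟨q, u⟩) 0) :
    HasFDerivAt (fun u : E => extChartAt I q (F ⟨q, u⟩)) (fibreDeriv I F q) 0 := by
  obtain ⟨L, h, hL⟩ : ∃ L : E →L[ℝ] E, HasFDerivWithinAt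
      (writtenInExtChartAt 𝓘(ℝ, E) I 0 (fun u : E => F ⟨q, u⟩)) L (range 𝓘(ℝ, E)) 0 ∧
      L = fibreDeriv I F q := ⟨_, hF.hasMFDerivAt.2, rfl⟩
  rw [ModelWithCorners.range_eq_univ, hasFDerivWithinAt_univ] at h
  have h2 : writtenInExtChartAt 𝓘(ℝ, E) I 0 (fun u : E => F ⟨q, u⟩) =
      fun u : E => extChartAt I q (F ⟨q, u⟩) := by
    funext u
    simp only [writtenInExtChartAt, Function.comp_apply, extChartAt_model_space_eq_id,
      PartialEquiv.refl_symm, PartialEquiv.refl_coe, id]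
    exact congrArg (fun p => extChartAt I p (F ⟨q, u⟩)) h0
  rwa [h2, hL] at h

/-- The derivative along a fibre, read in an arbitrary chart. -/
lemma deriv_extChartAt_fibre {F : TangentBundle I M → M} {q p : M} (h0 : F ⟨q, 0⟩ = q)
    (hF : ContMDiffAt I.tangent I ∞ F ⟨q, 0⟩) (hq : q ∈ (extChartAt I p).source) (u : E) :
    deriv (fun t : ℝ => extChartAt I p (F ⟨q, t • u⟩)) 0 =
      tangentCoordChange I q p q (fibreDeriv I F q u) := by
  have hFq : ContMDiffAt 𝓘(ℝ, E) I ∞ (fun u : E => F ⟨q, u⟩) 0 :=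
    ContMDiffAt.comp (0 : E) hF (contMDiff_fibre q 0)
  have h1 := fibreDeriv_eq_fderiv h0 (hFq.mdifferentiableAt (by simp))
  have hline : HasDerivAt (fun t : ℝ => t • u) u 0 := by
    simpa using (hasDerivAt_id (0 : ℝ)).smul_const u
  have hγ : ContMDiffAt 𝓘(ℝ, ℝ) I ∞ (fun t : ℝ => F ⟨q, t • u⟩) 0 := by
    refine ContMDiffAt.comp (0 : ℝ) (g := fun u : E => F ⟨q, u⟩) (f := fun t : ℝ => t • u) ?_
      (contDiff_id.smul contDiff_const).contDiffAt.contMDiffAt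
    simpa using hFq
  have hγ0 : F ⟨q, (0 : ℝ) • u⟩ = q :=
    (congrArg (fun u : E => F ⟨q, u⟩) (zero_smul ℝ u)).trans h0
  have h2 : HasDerivAt (fun t : ℝ => extChartAt I q (F ⟨q, t • u⟩)) (fibreDeriv I F q u) 0 := by
    refine HasFDerivAt.comp_hasDerivAt (l := fun u : E => extChartAt I q (F ⟨q, u⟩))
      (f := fun t : ℝ => t • u) (0 : ℝ) ?_ hline
    simpa using h1
  -- The velocity of this curve does not depend on a chart. Computed in the chart at `q` it is the
  -- fibre derivative; its second coordinate in the chart at `p` is the derivative sought, and the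
  -- two differ by the tangent coordinate change.
  have h3 : velocity I (fun t : ℝ => F ⟨q, t • u⟩) =
      (⟨q, fibreDeriv I F q u⟩ : TangentBundle I M) :=
    velocity_eq_of_hasDerivAt hγ.continuousAt hγ0 h2
  have h4 := extChartAt_velocity (⟨p, 0⟩ : TangentBundle I M) (hγ.mdifferentiableAt (by simp))
    (by rw [hγ0, ← extChartAt_source I]; exact hq)
  rw [h3, extChartAt_tangent_apply] at h4
  exact (congrArg Prod.snd h4).symm

end TangentChart

/-! ### The canonical identification in polynomial coordinates -/

section Flip

variable {E H M : Type*} [NormedAddCommGroup E] [NormedSpace ℝ E] [TopologicalSpace H]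
  [TopologicalSpace M] [ChartedSpace H M] {I : ModelWithCorners ℝ E H} [IsManifold I ∞ M]
  [I.Boundaryless] {k : ℕ}

/-- The curve in `TM` with coordinates `(∑ sʲ aⱼ, ∑ sʲ bⱼ)` in the chart induced by the chart
at `q`. -/
noncomputable def tangentPolyCurve (I : ModelWithCorners ℝ E H) [IsManifold I ∞ M] (q : M)
    (p : ((Fin (k + 1) → E) × (Fin (k + 1) → E)) × ℝ) : TangentBundle I M :=
  (extChartAt I.tangent (⟨q, 0⟩ : TangentBundle I M)).symm
    (polyCurve p.1.1 p.2, polyCurve p.1.2 p.2)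

lemma polyCurve_smul (t : ℝ) (v : Fin (k + 1) → E) (s : ℝ) :
    polyCurve (t • v) s = t • polyCurve v s := by
  simp only [polyCurve, Finset.smul_sum, Pi.smul_apply]
  exact Finset.sum_congr rfl fun j _ => smul_comm _ _ _

lemma polyCurve_add (v v' : Fin (k + 1) → E) (s : ℝ) :
    polyCurve (v + v') s = polyCurve v s + polyCurve v' s := by
  simp [polyCurve, Finset.sum_add_distrib]

lemma contDiff_polyCurve_right (v : Fin (k + 1) → E) : ContDiff ℝ ∞ (polyCurve v) :=
  contDiff_polyCurve.comp (contDiff_const.prodMk contDiff_id)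

lemma contMDiffAt_tangentPolyCurve {q : M}
    {p : ((Fin (k + 1) → E) × (Fin (k + 1) → E)) × ℝ}
    (hp : polyCurve p.1.1 p.2 ∈ (extChartAt I q).target) :
    ContMDiffAt 𝓘(ℝ, ((Fin (k + 1) → E) × (Fin (k + 1) → E)) × ℝ) I.tangent ∞
      (tangentPolyCurve I q) p := by
  have h1 := contMDiffAt_extend_symm (I := I.tangent)
    (chart_mem_atlas (ModelProd H E) (⟨q, 0⟩ : TangentBundle I M))
    (mem_extChartAt_tangent_target (w := ⟨q, 0⟩) (v := polyCurve p.1.2 p.2) hp)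
  have h2 : ContDiff ℝ ∞ (fun p : ((Fin (k + 1) → E) × (Fin (k + 1) → E)) × ℝ =>
      (polyCurve p.1.1 p.2, polyCurve p.1.2 p.2)) :=
    (contDiff_polyCurve.comp (contDiff_fst.fst.prodMk contDiff_snd)).prodMk
      (contDiff_polyCurve.comp (contDiff_fst.snd.prodMk contDiff_snd))
  exact ContMDiffAt.comp p h1 h2.contDiffAt.contMDiffAt

lemma eventually_polyCurve_mem {q : M} {p : ((Fin (k + 1) → E) × (Fin (k + 1) → E)) × ℝ}
    (hp : polyCurve p.1.1 p.2 ∈ (extChartAt I q).target) :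
    ∀ᶠ p' in 𝓝 p, polyCurve p'.1.1 p'.2 ∈ (extChartAt I q).target := by
  have h : Continuous fun p : ((Fin (k + 1) → E) × (Fin (k + 1) → E)) × ℝ =>
      polyCurve p.1.1 p.2 :=
    (contDiff_polyCurve (E := E)).continuous.comp
      (continuous_fst.fst.prodMk continuous_snd)
  exact h.continuousAt.eventually ((isOpen_extChartAt_target q).mem_nhds hp)

lemma isCurve_tangentPolyCurve {q : M} {ab : (Fin (k + 1) → E) × (Fin (k + 1) → E)}
    (h : ab.1 0 ∈ (extChartAt I q).target) :
    IsCurve I.tangent (fun s => tangentPolyCurve I q (ab, s)) := by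
  have hc : ContinuousAt (fun s : ℝ => (ab, s)) 0 := by fun_prop
  have h0 := eventually_polyCurve_mem (I := I) (q := q) (p := (ab, 0))
    (by simpa [polyCurve_zero] using h)
  filter_upwards [hc.eventually h0] with s hs
  refine ContMDiffAt.comp s (f := fun s : ℝ => (ab, s)) (contMDiffAt_tangentPolyCurve hs) ?_
  exact (contDiff_const.prodMk contDiff_id).contDiffAt.contMDiffAt

/-- The two-parameter family of points with coordinates `∑ sʲ (aⱼ + t bⱼ)` in the chart at `q`. -/
noncomputable def polyFamily (I : ModelWithCorners ℝ E H) (q : M)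
    (ab : (Fin (k + 1) → E) × (Fin (k + 1) → E)) (p : ℝ × ℝ) : M :=
  (extChartAt I q).symm (polyCurve (ab.1 + p.1 • ab.2) p.2)

lemma contDiff_polyCurve_line (ab : (Fin (k + 1) → E) × (Fin (k + 1) → E)) :
    ContDiff ℝ ∞ fun p : ℝ × ℝ => polyCurve (ab.1 + p.1 • ab.2) p.2 :=
  contDiff_polyCurve.comp (f := fun p : ℝ × ℝ => (ab.1 + p.1 • ab.2, p.2)) (by fun_prop)

lemma eventually_polyCurve_line_mem {q : M} {ab : (Fin (k + 1) → E) × (Fin (k + 1) → E)}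
    (h : ab.1 0 ∈ (extChartAt I q).target) :
    ∀ᶠ p : ℝ × ℝ in 𝓝 0, polyCurve (ab.1 + p.1 • ab.2) p.2 ∈ (extChartAt I q).target := by
  refine (contDiff_polyCurve_line ab).continuous.continuousAt.eventually
    ((isOpen_extChartAt_target q).mem_nhds ?_)
  simpa [polyCurve_zero] using h

lemma isFamily_polyFamily {q : M} {ab : (Fin (k + 1) → E) × (Fin (k + 1) → E)}
    (h : ab.1 0 ∈ (extChartAt I q).target) : IsFamily I (polyFamily I q ab) := by
  filter_upwards [eventually_polyCurve_line_mem h] with p hpt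
  exact (contMDiffAt_extend_symm (chart_mem_atlas H q) hpt).comp p
    (contDiff_polyCurve_line ab).contDiffAt.contMDiffAt

/-- The velocities of the family `polyFamily` are given by `tangentPolyCurve`. -/
lemma velocity_polyFamily {q : M} {ab : (Fin (k + 1) → E) × (Fin (k + 1) → E)}
    (h : ab.1 0 ∈ (extChartAt I q).target) :
    (fun s => velocity I (fun t => polyFamily I q ab (t, s))) =ᶠ[𝓝 0]
      fun s => tangentPolyCurve I q (ab, s) := by
  have hc := isFamily_polyFamily h
  have hpev := eventually_polyCurve_line_mem h
  have hc0 : polyFamily I q ab 0 ∈ (chartAt H q).source := by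
    rw [← extChartAt_source I]
    exact (extChartAt I q).map_target hpev.self_of_nhds
  obtain ⟨O, hO, h0, hsm, hsrc, -⟩ := hc.exists_open hc0
  have hcont : ContinuousAt (fun s : ℝ => ((0, s) : ℝ × ℝ)) 0 := by fun_prop
  -- For fixed `s`, the derivative in `t` needs the chart identity on a whole neighbourhood of `t =
  -- 0`, hence the nested quantifiers.
  have hev : ∀ᶠ s : ℝ in 𝓝 0, ∀ᶠ t : ℝ in 𝓝 0,
      polyCurve (ab.1 + t • ab.2) s ∈ (extChartAt I q).target := by
    filter_upwards [hcont.eventually hpev.eventually_nhds] with s hs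
    have hcs : ContinuousAt (fun t : ℝ => ((t, s) : ℝ × ℝ)) 0 := by fun_prop
    exact hcs.eventually hs
  filter_upwards [hcont.eventually (hO.mem_nhds h0), hc.velocity_chart ⟨q, 0⟩ hc0, hev]
    with s hs hs' ht
  have hmem : velocity I (fun t => polyFamily I q ab (t, s)) ∈
      (extChartAt I.tangent (⟨q, 0⟩ : TangentBundle I M)).source := by
    rw [extChartAt_source, TangentBundle.mem_chart_source_iff]
    exact hsrc _ hs
  -- Both sides become points of `TM` given by coordinates. Those of the velocity are the point and
  -- its `t`-derivative, by `IsFamily.velocity_chart`.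
  rw [tangentPolyCurve, ← (extChartAt I.tangent _).left_inv hmem]
  refine congrArg _ (hs'.trans (Prod.ext ?_ ?_))
  · refine ((extChartAt I q).right_inv ht.self_of_nhds).trans ?_
    simp
  · have h1 : HasDerivAt (fun t : ℝ => polyCurve ab.1 s + t • polyCurve ab.2 s)
        (polyCurve ab.2 s) 0 := by
      simpa using ((hasDerivAt_id (0 : ℝ)).smul_const (polyCurve ab.2 s)).const_add
        (polyCurve ab.1 s)
    refine HasDerivAt.deriv (h1.congr_of_eventuallyEq ?_)
    filter_upwards [ht] with t ht
    refine ((extChartAt I q).right_inv ht).trans ?_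
    rw [polyCurve_add, polyCurve_smul]

/-- The tangent vector with coordinates `ab` is represented by the family `polyFamily`. -/
lemma velocity_jet_polyFamily {X₀ X : TangentBundle (jetModel E k) (JetBundle I k M)}
    (hX : X.1 ∈ (chartAt (Fin (k + 1) → E) X₀.1).source)
    {ab : (Fin (k + 1) → E) × (Fin (k + 1) → E)}
    (hab : extChartAt (jetModel E k).tangent X₀ X = ab) :
    velocity (jetModel E k) (fun t => jet I k (fun s => polyFamily I X₀.1.base ab (t, s))) = X := by
  let J : OpenPartialHomeomorph (JetBundle I k M) (Fin (k + 1) → E) :=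
    chartAt (Fin (k + 1) → E) X₀.1
  have hXs : X.1 ∈ J.source := hX
  have ha : ab.1 = J X.1 := by rw [← hab]; rfl
  have hline : HasDerivAt (fun t : ℝ => ab.1 + t • ab.2) ab.2 0 := by
    simpa using ((hasDerivAt_id (0 : ℝ)).smul_const ab.2).const_add ab.1
  have hlev : ∀ᶠ t : ℝ in 𝓝 0, ab.1 + t • ab.2 ∈ J.target := by
    refine hline.continuousAt.eventually (J.open_target.mem_nhds ?_)
    change ab.1 + (0 : ℝ) • ab.2 ∈ J.target
    rw [zero_smul, add_zero, ha]
    exact J.map_source hXs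
  -- The inverse of a chart of the jet bundle is defined by polynomial curves, so this curve of jets
  -- is a straight line in the chart `J`.
  have hjet : (fun t => jet I k (fun s => polyFamily I X₀.1.base ab (t, s))) =
      fun t : ℝ => J.symm (ab.1 + t • ab.2) := rfl
  rw [hjet]
  have hd : MDifferentiableAt 𝓘(ℝ, ℝ) (jetModel E k) (fun t : ℝ => J.symm (ab.1 + t • ab.2)) 0 := by
    have h1 : ContMDiffAt 𝓘(ℝ, Fin (k + 1) → E) (jetModel E k) ∞ J.symm (ab.1 + (0 : ℝ) • ab.2) := by
      refine (contMDiffOn_chart_symm (I := jetModel E k) (x := X₀.1)).contMDiffAt ?_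
      exact J.open_target.mem_nhds hlev.self_of_nhds
    have h2 : ContDiff ℝ ∞ (fun t : ℝ => ab.1 + t • ab.2) := by fun_prop
    exact (ContMDiffAt.comp (0 : ℝ) h1 h2.contDiffAt.contMDiffAt).mdifferentiableAt (by simp)
  have hj0 : J.symm (ab.1 + (0 : ℝ) • ab.2) = X.1 := by
    rw [zero_smul, add_zero, ha, J.left_inv hXs]
  have hs : ∀ Y : TangentBundle (jetModel E k) (JetBundle I k M), Y.1 ∈ J.source →
      Y ∈ (extChartAt (jetModel E k).tangent X₀).source := fun Y hY => by
    rw [extChartAt_source, TangentBundle.mem_chart_source_iff]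
    exact hY
  refine (extChartAt (jetModel E k).tangent X₀).injOn (hs _ ?_) (hs _ hXs) ?_
  · change J.symm (ab.1 + (0 : ℝ) • ab.2) ∈ J.source
    rwa [hj0]
  · rw [extChartAt_velocity X₀ hd (by rw [hj0]; exact hXs), hab]
    refine Prod.ext ?_ ?_
    · change J (J.symm (ab.1 + (0 : ℝ) • ab.2)) = ab.1
      rw [hj0, ha]
    · refine HasDerivAt.deriv (hline.congr_of_eventuallyEq ?_)
      filter_upwards [hlev] with t ht
      exact J.right_inv ht

/-- The target of a chart of the jet bundle constrains only the coefficient of order zero. -/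
lemma extChartAt_jet_mem_target {X₀ X : TangentBundle (jetModel E k) (JetBundle I k M)}
    (hX : X.1 ∈ (chartAt (Fin (k + 1) → E) X₀.1).source) :
    (extChartAt (jetModel E k).tangent X₀ X).1 0 ∈ (extChartAt I X₀.1.base).target :=
  (chartAt (Fin (k + 1) → E) X₀.1).map_source hX

/-- `Φ⁽ᵏ⁾` in coordinates. -/
lemma canonicalFlip_eq_jet {X₀ X : TangentBundle (jetModel E k) (JetBundle I k M)}
    (hX : X.1 ∈ (chartAt (Fin (k + 1) → E) X₀.1).source) :
    canonicalFlip I k X = jet I.tangent k (fun s =>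
      tangentPolyCurve I X₀.1.base (extChartAt (jetModel E k).tangent X₀ X, s)) := by
  have ha := extChartAt_jet_mem_target hX
  -- Independence of the family allows the one chosen in `canonicalFlip` to be replaced by
  -- `polyFamily` with the coordinates of `X`.
  have h1 := canonicalFlip_velocity_jet (k := k) (isFamily_polyFamily ha)
  rw [velocity_jet_polyFamily hX rfl] at h1
  rw [h1]
  exact jet_congr (isFamily_polyFamily ha).isCurve_velocity (velocity_polyFamily ha)

lemma base_canonicalFlip {X₀ X : TangentBundle (jetModel E k) (JetBundle I k M)}
    (hX : X.1 ∈ (chartAt (Fin (k + 1) → E) X₀.1).source) :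
    (canonicalFlip I k X).base =
      tangentPolyCurve I X₀.1.base (extChartAt (jetModel E k).tangent X₀ X, 0) := by
  rw [canonicalFlip_eq_jet hX, jet_base (isCurve_tangentPolyCurve (extChartAt_jet_mem_target hX))]

end Flip

end HigherTangent

namespace HigherTangent

/-! ### The lift: domain, smoothness, zero section, rigidity -/

section Lift

variable {E H M : Type*} [NormedAddCommGroup E] [NormedSpace ℝ E] [TopologicalSpace H]
  [TopologicalSpace M] [ChartedSpace H M] {I : ModelWithCorners ℝ E H} [IsManifold I ∞ M]
  [I.Boundaryless] {k : ℕ} {U : Set (TangentBundle I M)} {R : TangentBundle I M → M × M}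

lemma IsDiscretizationMap.contMDiffAt (hR : IsDiscretizationMap I U R) {w : TangentBundle I M}
    (hw : w ∈ U) : ContMDiffAt I.tangent (I.prod I) ∞ R w :=
  hR.smooth.contMDiffAt (hR.isOpen.mem_nhds hw)

/-- The lift of a discretization map in coordinates. -/
lemma IsDiscretizationMap.lift_eq_jet (hR : IsDiscretizationMap I U R)
    {X₀ X : TangentBundle (jetModel E k) (JetBundle I k M)}
    (hX : X.1 ∈ (chartAt (Fin (k + 1) → E) X₀.1).source) (hXU : X ∈ liftDomain I k U) :
    discretizationLift I k R X =
      (jet I k (fun s => (R (tangentPolyCurve I X₀.1.base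
          (extChartAt (jetModel E k).tangent X₀ X, s))).1),
        jet I k (fun s => (R (tangentPolyCurve I X₀.1.base
          (extChartAt (jetModel E k).tangent X₀ X, s))).2)) := by
  have hc := isCurve_tangentPolyCurve (extChartAt_jet_mem_target hX)
  have h0 : tangentPolyCurve I X₀.1.base (extChartAt (jetModel E k).tangent X₀ X, 0) ∈ U := by
    rw [← base_canonicalFlip hX]
    exact hXU
  have hev : ∀ᶠ y in 𝓝 (tangentPolyCurve I X₀.1.base
      (extChartAt (jetModel E k).tangent X₀ X, 0)), ContMDiffAt I.tangent (I.prod I) ∞ R y := by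
    filter_upwards [hR.isOpen.mem_nhds h0] with y hy
    exact hR.contMDiffAt hy
  rw [discretizationLift, canonicalFlip_eq_jet hX, jetMap_jet hc hev, jetProd,
    jetMap_jet (hc.comp hev) (Eventually.of_forall fun _ => contMDiffAt_fst),
    jetMap_jet (hc.comp hev) (Eventually.of_forall fun _ => contMDiffAt_snd)]
  rfl

lemma eventually_fst_mem_chart_source (X₀ : TangentBundle (jetModel E k) (JetBundle I k M)) :
    ∀ᶠ X in 𝓝 X₀, X.1 ∈ (chartAt (Fin (k + 1) → E) X₀.1).source := by
  have h := (chartAt (ModelProd (Fin (k + 1) → E) (Fin (k + 1) → E)) X₀).open_source.mem_nhds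
    (mem_chart_source _ X₀)
  filter_upwards [h] with X hX
  exact (TangentBundle.mem_chart_source_iff _ _).1 hX

lemma continuousAt_tangentPolyCurve_zero (X₀ : TangentBundle (jetModel E k) (JetBundle I k M)) :
    ContinuousAt (fun X => tangentPolyCurve I X₀.1.base
      (extChartAt (jetModel E k).tangent X₀ X, 0)) X₀ := by
  have h1 : ContinuousAt (tangentPolyCurve I X₀.1.base)
      (extChartAt (jetModel E k).tangent X₀ X₀, (0 : ℝ)) := by
    refine (contMDiffAt_tangentPolyCurve ?_).continuousAt
    rw [polyCurve_zero]
    exact extChartAt_jet_mem_target (mem_chart_source _ X₀.1)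
  exact ContinuousAt.comp
    (f := fun X => (extChartAt (jetModel E k).tangent X₀ X, (0 : ℝ))) h1
    ((continuousAt_extChartAt X₀).prodMk continuousAt_const)

/-- In the chart at a fixed `X₀`, the base of the flip is a continuous function of `X`, by
`base_canonicalFlip`, and `U` is open. -/
lemma isOpen_liftDomain (hU : IsOpen U) : IsOpen (liftDomain I k U) := by
  refine isOpen_iff_mem_nhds.2 fun X₀ hX₀ => ?_
  have h0 : tangentPolyCurve I X₀.1.base (extChartAt (jetModel E k).tangent X₀ X₀, 0) ∈ U := by
    rw [← base_canonicalFlip (mem_chart_source _ X₀.1)]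
    exact hX₀
  filter_upwards [eventually_fst_mem_chart_source X₀,
    (continuousAt_tangentPolyCurve_zero X₀).eventually (hU.mem_nhds h0)] with X hX hXU
  change (canonicalFlip I k X).base ∈ U
  rwa [base_canonicalFlip hX]

/-- A smooth map composed with the curves `tangentPolyCurve`. -/
lemma eventually_contMDiffAt_comp_tangentPolyCurve {F : TangentBundle I M → M} {q : M}
    (hU : IsOpen U) (hF : ∀ w ∈ U, ContMDiffAt I.tangent I ∞ F w)
    {ab : (Fin (k + 1) → E) × (Fin (k + 1) → E)} (h : ab.1 0 ∈ (extChartAt I q).target)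
    (h0 : tangentPolyCurve I q (ab, 0) ∈ U) :
    ∀ᶠ p in 𝓝 (ab, (0 : ℝ)),
      ContMDiffAt 𝓘(ℝ, ((Fin (k + 1) → E) × (Fin (k + 1) → E)) × ℝ) I ∞
        (fun p => F (tangentPolyCurve I q p)) p := by
  have h' : polyCurve (ab, (0 : ℝ)).1.1 (ab, (0 : ℝ)).2 ∈ (extChartAt I q).target := by
    rwa [polyCurve_zero]
  filter_upwards [eventually_polyCurve_mem h',
    (contMDiffAt_tangentPolyCurve h').continuousAt.eventually (hU.mem_nhds h0)] with p hp hpU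
  exact ContMDiffAt.comp p (hF _ hpU) (contMDiffAt_tangentPolyCurve hp)

lemma IsDiscretizationMap.contMDiffAt_fst (hR : IsDiscretizationMap I U R) :
    ∀ w ∈ U, ContMDiffAt I.tangent I ∞ (fun w => (R w).1) w :=
  fun _ hw => (hR.contMDiffAt hw).fst

lemma IsDiscretizationMap.contMDiffAt_snd (hR : IsDiscretizationMap I U R) :
    ∀ w ∈ U, ContMDiffAt I.tangent I ∞ (fun w => (R w).2) w :=
  fun _ hw => (hR.contMDiffAt hw).snd

/-- Near `X₀` each component is the jet of a smooth family of curves whose parameter is the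
coordinate vector of `X`, so `contMDiffAt_jet` is composed with the chart. -/
lemma IsDiscretizationMap.contMDiffOn_lift (hR : IsDiscretizationMap I U R) :
    ContMDiffOn (jetModel E k).tangent ((jetModel E k).prod (jetModel E k)) ∞
      (discretizationLift I k R) (liftDomain I k U) := by
  intro X₀ hX₀
  have h0 : tangentPolyCurve I X₀.1.base (extChartAt (jetModel E k).tangent X₀ X₀, 0) ∈ U := by
    rw [← base_canonicalFlip (mem_chart_source _ X₀.1)]
    exact hX₀
  have hjet : ∀ F : TangentBundle I M → M, (∀ w ∈ U, ContMDiffAt I.tangent I ∞ F w) →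
      ContMDiffAt (jetModel E k).tangent (jetModel E k) ∞ (fun X =>
        jet I k (fun s => F (tangentPolyCurve I X₀.1.base
          (extChartAt (jetModel E k).tangent X₀ X, s)))) X₀ := fun F hF =>
    ContMDiffAt.comp X₀ (contMDiffAt_jet (eventually_contMDiffAt_comp_tangentPolyCurve hR.isOpen hF
      (extChartAt_jet_mem_target (mem_chart_source _ X₀.1)) h0)) contMDiffAt_extChartAt
  have h := (hjet _ hR.contMDiffAt_fst).prodMk (hjet _ hR.contMDiffAt_snd)
  refine (h.congr_of_eventuallyEq ?_).contMDiffWithinAt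
  filter_upwards [eventually_fst_mem_chart_source X₀,
    (isOpen_liftDomain hR.isOpen).mem_nhds hX₀] with X hX hXU
  exact hR.lift_eq_jet hX hXU

/-- `Φ⁽ᵏ⁾` maps zero vectors to jets of curves in the zero section. -/
lemma canonicalFlip_zero (z : JetBundle I k M) :
    IsCurve I.tangent (fun s => (⟨z.rep s, 0⟩ : TangentBundle I M)) ∧
    canonicalFlip I k ⟨z, 0⟩ = jet I.tangent k (fun s => (⟨z.rep s, 0⟩ : TangentBundle I M)) := by
  -- The zero vector at `z` is represented by the family that is constant in `t`.
  have hc : IsFamily I (fun p : ℝ × ℝ => z.rep p.2) := by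
    have hcont : ContinuousAt (fun p : ℝ × ℝ => p.2) 0 := by fun_prop
    filter_upwards [hcont.eventually z.isCurve_rep] with p hp
    exact ContMDiffAt.comp p (g := z.rep) hp contDiff_snd.contDiffAt.contMDiffAt
  have h1 : velocity (jetModel E k) (fun _ : ℝ => jet I k (fun s => z.rep s)) = ⟨z, 0⟩ := by
    rw [velocity, mfderiv_const]
    exact congrArg (fun z => (⟨z, 0⟩ : TangentBundle (jetModel E k) (JetBundle I k M))) (jet_rep z)
  have h2 : (fun s : ℝ => velocity I (fun _ : ℝ => z.rep s)) =
      fun s => (⟨z.rep s, 0⟩ : TangentBundle I M) := by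
    funext s
    rw [velocity, mfderiv_const]
    rfl
  have h3 := hc.isCurve_velocity
  have h4 := canonicalFlip_velocity_jet (k := k) hc
  simp only [h2] at h3 h4
  rw [h1] at h4
  exact ⟨h3, h4⟩

lemma IsDiscretizationMap.zero_mem_liftDomain (hR : IsDiscretizationMap I U R)
    (z : JetBundle I k M) :
    (⟨z, 0⟩ : TangentBundle (jetModel E k) (JetBundle I k M)) ∈ liftDomain I k U := by
  obtain ⟨h1, h2⟩ := canonicalFlip_zero z
  change (canonicalFlip I k ⟨z, 0⟩).base ∈ U
  rw [h2, jet_base h1]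
  exact hR.zero_mem _

lemma IsDiscretizationMap.lift_zero (hR : IsDiscretizationMap I U R) (z : JetBundle I k M) :
    discretizationLift I k R ⟨z, 0⟩ = (z, z) := by
  obtain ⟨h1, h2⟩ := canonicalFlip_zero z
  have hev : ∀ᶠ y in 𝓝 (⟨z.rep 0, 0⟩ : TangentBundle I M),
      ContMDiffAt I.tangent (I.prod I) ∞ R y := by
    filter_upwards [hR.isOpen.mem_nhds (hR.zero_mem _)] with y hy
    exact hR.contMDiffAt hy
  have h3 : R ∘ (fun s => (⟨z.rep s, 0⟩ : TangentBundle I M)) = fun s => (z.rep s, z.rep s) :=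
    funext fun s => hR.map_zero _
  have h4 := h1.comp hev
  rw [discretizationLift, h2, jetMap_jet h1 hev, jetProd,
    jetMap_jet h4 (Eventually.of_forall fun _ => _root_.contMDiffAt_fst),
    jetMap_jet h4 (Eventually.of_forall fun _ => _root_.contMDiffAt_snd), h3]
  exact Prod.ext (jet_rep z) (jet_rep z)

/-! ### Rigidity -/

/-- The coordinate expression of the two components of a discretization map, differentiated along
a fibre: rigidity holds in every chart. -/
lemma IsDiscretizationMap.deriv_sub_deriv (hR : IsDiscretizationMap I U R) {q : M} {y v : E}
    (hy : y ∈ (extChartAt I q).target) :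
    deriv (fun t : ℝ => extChartAt I q
        (R ((extChartAt I.tangent (⟨q, 0⟩ : TangentBundle I M)).symm (y, t • v))).2) 0 -
      deriv (fun t : ℝ => extChartAt I q
        (R ((extChartAt I.tangent (⟨q, 0⟩ : TangentBundle I M)).symm (y, t • v))).1) 0 = v := by
  obtain ⟨u, hu, hsymm⟩ := exists_extChartAt_tangent_symm (⟨q, 0⟩ : TangentBundle I M) hy v
  have hq := (extChartAt I q).map_target hy
  have hz := hR.zero_mem ((extChartAt I q).symm y)
  have h0 := hR.map_zero ((extChartAt I q).symm y)
  have h1 := deriv_extChartAt_fibre (F := fun w => (R w).1) (q := (extChartAt I q).symm y) (p := q)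
    (congrArg Prod.fst h0)
    (hR.contMDiffAt_fst _ hz) hq u
  have h2 := deriv_extChartAt_fibre (F := fun w => (R w).2) (q := (extChartAt I q).symm y) (p := q)
    (congrArg Prod.snd h0)
    (hR.contMDiffAt_snd _ hz) hq u
  simp only [hsymm]
  refine (congrArg₂ (· - ·) h2 h1).trans ?_
  -- Both derivatives are images under the same linear coordinate change, so the difference is the
  -- image of `u` by rigidity at that point, and `u` was chosen to have coordinates `v`.
  rw [← map_sub, ← sub_apply, hR.rigid]
  exact hu

lemma jetCoord_zero_mem_target (z : JetBundle I k M) :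
    jetCoord (chartAt H z.base) z 0 ∈ (extChartAt I z.base).target := by
  have h0 : jetCoord (chartAt H z.base) z 0 = extChartAt I z.base z.base := by
    simp [jetCoord, JetBundle.base, extChartAt]
  exact h0 ▸ mem_extChartAt_target z.base

/-- The derivative along a fibre of a map that is given by jets in coordinates. -/
lemma fibreDeriv_jet {L : TangentBundle (jetModel E k) (JetBundle I k M) → JetBundle I k M}
    {F : TangentBundle I M → M} {z : JetBundle I k M} (hU : IsOpen U)
    (hF : ∀ w ∈ U, ContMDiffAt I.tangent I ∞ F w) (hz : L ⟨z, 0⟩ = z)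
    (hzU : tangentPolyCurve I z.base ((jetCoord (chartAt H z.base) z, 0), 0) ∈ U)
    (hF0 : F (tangentPolyCurve I z.base ((jetCoord (chartAt H z.base) z, 0), 0)) = z.base)
    (hL : ∀ᶠ b : Fin (k + 1) → E in 𝓝 0, L ⟨z, b⟩ = jet I k (fun s =>
      F (tangentPolyCurve I z.base ((jetCoord (chartAt H z.base) z, b), s))))
    (β : Fin (k + 1) → E) (r : Fin (k + 1)) :
    fibreDeriv (jetModel E k) L z β r = ((r : ℕ).factorial : ℝ)⁻¹ •
        iteratedDeriv r (fun s => deriv (fun t : ℝ => extChartAt I z.base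
          (F ((extChartAt I.tangent (⟨z.base, 0⟩ : TangentBundle I M)).symm
            (polyCurve (jetCoord (chartAt H z.base) z) s, t • polyCurve β s)))) 0) 0 ∧
      ContDiffAt ℝ ∞ (fun s => deriv (fun t : ℝ => extChartAt I z.base
          (F ((extChartAt I.tangent (⟨z.base, 0⟩ : TangentBundle I M)).symm
            (polyCurve (jetCoord (chartAt H z.base) z) s, t • polyCurve β s)))) 0) 0 := by
  set a := jetCoord (chartAt H z.base) z
  have ha : a 0 ∈ (extChartAt I z.base).target := jetCoord_zero_mem_target z
  -- The base coordinates `a` are frozen; only the fibre coordinates vary.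
  let G : (Fin (k + 1) → E) × ℝ → M := fun p => F (tangentPolyCurve I z.base ((a, p.1), p.2))
  have hG : ∀ᶠ p in 𝓝 ((0 : Fin (k + 1) → E), (0 : ℝ)),
      ContMDiffAt 𝓘(ℝ, (Fin (k + 1) → E) × ℝ) I ∞ G p := by
    have hι : ContDiff ℝ ∞ (fun p : (Fin (k + 1) → E) × ℝ => ((a, p.1), p.2)) := by fun_prop
    have h := eventually_contMDiffAt_comp_tangentPolyCurve hU hF (ab := (a, 0)) ha hzU
    filter_upwards [hι.continuous.continuousAt.eventually h] with p hp
    exact ContMDiffAt.comp p (g := fun p => F (tangentPolyCurve I z.base p))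
      (f := fun p : (Fin (k + 1) → E) × ℝ => ((a, p.1), p.2)) hp hι.contDiffAt.contMDiffAt
  have hG0 : G (0, 0) ∈ (chartAt H z.base).source := by
    change F _ ∈ _
    rw [hF0]
    exact mem_chart_source H _
  have hmd : MDifferentiableAt 𝓘(ℝ, Fin (k + 1) → E) (jetModel E k)
      (fun b : Fin (k + 1) → E => L ⟨z, b⟩) 0 :=
    ((contMDiffAt_jet hG).congr_of_eventuallyEq hL).mdifferentiableAt (by simp)
  have h1 : HasFDerivAt (fun b : Fin (k + 1) → E => jetCoord (chartAt H z.base) (L ⟨z, b⟩))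
      (fibreDeriv (jetModel E k) L z) 0 := fibreDeriv_eq_fderiv hz hmd
  have h2 : (fun b : Fin (k + 1) → E => jetCoord (chartAt H z.base) (L ⟨z, b⟩)) =ᶠ[𝓝 0]
      fun b => jetCoord (chartAt H z.base) (jet I k (fun s => G (b, s))) := by
    filter_upwards [hL] with b hb
    rw [hb]
  have h3 := fderiv_jetCoord (k := k) hG (chart_mem_atlas H z.base) hG0 β r
  -- Since `polyCurve` is linear in its coefficients, varying `t` moves along the fibre of `TM` over
  -- the point `a(s)`, in the direction `β(s)`.
  have h4 : ∀ (t s : ℝ), G (0 + t • β, s) =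
      F ((extChartAt I.tangent (⟨z.base, 0⟩ : TangentBundle I M)).symm
        (polyCurve a s, t • polyCurve β s)) := fun t s => by
    simp only [G, tangentPolyCurve, zero_add, polyCurve_smul]
  simp only [h4] at h3
  rw [← h2.fderiv_eq, h1.fderiv] at h3
  exact h3

lemma extChartAt_tangent_jet_fibre (z : JetBundle I k M) (b : Fin (k + 1) → E) :
    extChartAt (jetModel E k).tangent
        (⟨z, 0⟩ : TangentBundle (jetModel E k) (JetBundle I k M)) ⟨z, b⟩ =
      (jetCoord (chartAt H z.base) z, b) := by
  refine (extChartAt_tangent_apply _ z b).trans (Prod.ext rfl ?_)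
  exact tangentCoordChange_self (mem_extChartAt_source z)

lemma tangentPolyCurve_jetCoord_zero (z : JetBundle I k M) :
    tangentPolyCurve I z.base ((jetCoord (chartAt H z.base) z, 0), 0) =
      (⟨z.base, 0⟩ : TangentBundle I M) := by
  have h0 : jetCoord (chartAt H z.base) z 0 = extChartAt I z.base z.base := by
    simp [jetCoord, JetBundle.base, extChartAt]
  have hy := jetCoord_zero_mem_target z
  -- Linearity on fibres at `t = 0` gives the zero vector, whatever `u` is.
  obtain ⟨u, -, hu⟩ := exists_extChartAt_tangent_symm (⟨z.base, 0⟩ : TangentBundle I M) hy 0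
  have h1 := hu 0
  have hq : (extChartAt I z.base).symm (jetCoord (chartAt H z.base) z 0) = z.base := by
    rw [h0, extChartAt_to_inv]
  simp only [zero_smul] at h1
  simp only [tangentPolyCurve, polyCurve_zero, Pi.zero_apply]
  refine h1.trans ?_
  exact congrArg (fun q => (⟨q, 0⟩ : TangentBundle I M)) hq

/-- The lift of a discretization map on a fibre, near zero. -/
lemma IsDiscretizationMap.eventually_lift_fibre (hR : IsDiscretizationMap I U R)
    (z : JetBundle I k M) :
    ∀ᶠ b : Fin (k + 1) → E in 𝓝 0, discretizationLift I k R ⟨z, b⟩ =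
      (jet I k (fun s => (R (tangentPolyCurve I z.base
          ((jetCoord (chartAt H z.base) z, b), s))).1),
        jet I k (fun s => (R (tangentPolyCurve I z.base
          ((jetCoord (chartAt H z.base) z, b), s))).2)) := by
  have hev : ∀ᶠ b : Fin (k + 1) → E in 𝓝 0,
      (⟨z, b⟩ : TangentBundle (jetModel E k) (JetBundle I k M)) ∈ liftDomain I k U :=
    (contMDiff_fibre (I := jetModel E k) z).continuous.continuousAt.eventually
      ((isOpen_liftDomain hR.isOpen).mem_nhds (hR.zero_mem_liftDomain z))
  filter_upwards [hev] with b hb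
  have h1 := hR.lift_eq_jet (X₀ := ⟨z, 0⟩) (mem_chart_source (Fin (k + 1) → E) z) hb
  rwa [extChartAt_tangent_jet_fibre] at h1

/-- By `fibreDeriv_jet` both derivatives are Taylor coefficients in `s` of fibre derivatives of `R`
along the curve `a(s)`. Their difference is `β(s)` by `IsDiscretizationMap.deriv_sub_deriv`, and its
coefficients are those of `β`. -/
lemma IsDiscretizationMap.lift_rigid (hR : IsDiscretizationMap I U R) (z : JetBundle I k M) :
    fibreDeriv (jetModel E k) (fun X => (discretizationLift I k R X).2) z -
      fibreDeriv (jetModel E k) (fun X => (discretizationLift I k R X).1) z =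
    ContinuousLinearMap.id ℝ (Fin (k + 1) → E) := by
  have ha := jetCoord_zero_mem_target z
  have hbase := tangentPolyCurve_jetCoord_zero z
  have hzU : tangentPolyCurve I z.base ((jetCoord (chartAt H z.base) z, 0), 0) ∈ U := by
    rw [hbase]
    exact hR.zero_mem z.base
  have hz := hR.lift_zero z
  have hb0 : R (tangentPolyCurve I z.base ((jetCoord (chartAt H z.base) z, 0), 0)) =
      (z.base, z.base) := by
    rw [hbase]
    exact hR.map_zero z.base
  have hL1 := (hR.eventually_lift_fibre z).mono fun b hb => congrArg Prod.fst hb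
  have hL2 := (hR.eventually_lift_fibre z).mono fun b hb => congrArg Prod.snd hb
  refine ContinuousLinearMap.ext fun β => funext fun r => ?_
  have h1 := fibreDeriv_jet (L := fun X => (discretizationLift I k R X).1)
    (F := fun w => (R w).1) (z := z) hR.isOpen hR.contMDiffAt_fst
    (by rw [hz]) hzU (by rw [hb0]) hL1 β r
  have h2 := fibreDeriv_jet (L := fun X => (discretizationLift I k R X).2)
    (F := fun w => (R w).2) (z := z) hR.isOpen hR.contMDiffAt_snd
    (by rw [hz]) hzU (by rw [hb0]) hL2 β r
  rw [sub_apply, Pi.sub_apply, h1.1, h2.1, ← smul_sub]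
  have hr : ((r : ℕ) : ℕ∞ω) ≤ ∞ := mod_cast le_top
  rw [← iteratedDeriv_fun_sub (h2.2.of_le hr) (h1.2.of_le hr)]
  generalize jetCoord (chartAt H z.base) z = a at ha ⊢
  have hcont : ContinuousAt (polyCurve a) 0 := (contDiff_polyCurve_right a).continuous.continuousAt
  have hpoly : (fun s => deriv (fun t : ℝ => extChartAt I z.base
        (R ((extChartAt I.tangent (⟨z.base, 0⟩ : TangentBundle I M)).symm
          (polyCurve a s, t • polyCurve β s))).2) 0 -
      deriv (fun t : ℝ => extChartAt I z.base
        (R ((extChartAt I.tangent (⟨z.base, 0⟩ : TangentBundle I M)).symm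
          (polyCurve a s, t • polyCurve β s))).1) 0) =ᶠ[𝓝 0] polyCurve β := by
    -- The curve `a(s)` stays in the chart only for small `s`, which suffices for derivatives at
    -- `0`.
    filter_upwards [hcont.eventually ((isOpen_extChartAt_target z.base).mem_nhds
      (by rwa [polyCurve_zero]))] with s hs
    exact hR.deriv_sub_deriv hs
  rw [hpoly.iteratedDeriv_eq, iteratedDeriv_polyCurve, inv_smul_smul₀ (by positivity)]
  rfl

end Lift

end HigherTangent

theorem mainTheorem1 {E H Q : Type*} [NormedAddCommGroup E] [NormedSpace ℝ E]
    [FiniteDimensional ℝ E] [TopologicalSpace H] (I : ModelWithCorners ℝ E H) [I.Boundaryless]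
    [TopologicalSpace Q] [ChartedSpace H Q] [IsManifold I ∞ Q] (k : ℕ)
    (U : Set (TangentBundle I Q)) (R : TangentBundle I Q → Q × Q)
    (hR : HigherTangent.IsDiscretizationMap I U R) :
    HigherTangent.IsDiscretizationMap (HigherTangent.jetModel E k)
      (HigherTangent.liftDomain I k U) (HigherTangent.discretizationLift I k R) :=
  ⟨HigherTangent.isOpen_liftDomain hR.isOpen, hR.zero_mem_liftDomain, hR.contMDiffOn_lift,
    hR.lift_zero, hR.lift_rigid⟩
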